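/- Let $(V,\Omega)$ be a finite-dimensional real symplectic vector space, and let $\mathcal R_0$ be the Lie group with underlying manifold $\mathbb R\times V\times\mathbb R$ and multiplication $$(a,x,z)\cdot(a',x',z')=\Big(a+a',\;e^{-a'}x+x',\;e^{-2a'}z+z'+\tfrac12\,\Omega(x,x')\,e^{-a'}\Big).$$ Let $dg=da\,dx\,dz$, where $dx$ is a Lebesgue (translation-invariant) measure on $V$; this is a left Haar measure on $\mathcal R_0$. Let $L^2(\mathcal R_0)$ be the complex $L^2$-space of $dg$, and let $(\lambda_g u)(h)=u(g^{-1}h)$ be the left regular representation. A vector $u\in L^2(\mathcal R_0)$ is smooth if $g\mapsto\lambda_g u$ is a $C^\infty$ map $\mathcal R_0\to L^2(\mathcal R_0)$; $L^2(\mathcal R_0)^\infty$ denotes the linear subspace of smooth vectors. For $g_i=(a_i,x_i,z_i)\in\mathcal R_0$ ($i=0,1,2$) put $S_V(y_0,y_1,y_2)=\Omega(y_0,y_1)+\Omega(y_1,y_2)+\Omega(y_2,y_0)$ and $$S=S_V\big(\cosh(a_1-a_2)x_0,\cosh(a_2-a_0)x_1,\cosh(a_0-a_1)x_2\big)-\big[\sinh(2(a_0-a_1))z_2+\sinh(2(a_1-a_2))z_0+\sinh(2(a_2-a_0))z_1\big],$$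 $$A=\Big[\cosh(2(a_1-a_2))\cosh(2(a_2-a_0))\cosh(2(a_0-a_1))\big(\cosh(a_1-a_2)\cosh(a_2-a_0)\cosh(a_0-a_1)\big)^{\dim\mathcal R_0-2}\Big]^{1/2}.$$ Let $\theta\in\mathbb R\setminus\{0\}$. Then there is exactly one continuous bilinear product $\star^{(2)}_\theta$ on $L^2(\mathcal R_0)$ such that for all smooth compactly supported functions $u,v:\mathcal R_0\to\mathbb C$, for almost every $g_0$, $$(u\star^{(2)}_\theta v)(g_0)=\frac1{\theta^{\dim\mathcal R_0}}\int_{\mathcal R_0\times\mathcal R_0}A(g_0,g_1,g_2)\,e^{\frac{2i}{\theta}S(g_0,g_1,g_2)}\,u(g_1)\,v(g_2)\,dg_1\,dg_2 ,$$ and the space of smooth vectors is closed under it: if $u,v\in L^2(\mathcal R_0)^\infty$ then $u\star^{(2)}_\theta v\in L^2(\mathcal R_0)^\infty$. Thus $L^2(\mathcal R_0)^\infty$ is a subalgebra of $(L^2(\mathcal R_0),\star^{(2)}_\theta)$. -/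

import Mathlib

open MeasureTheory

noncomputable section

/-- The underlying manifold of the group `R₀`, in its global coordinates `(a, x, z)`. -/
abbrev R0 (V : Type*) : Type _ := ℝ × V × ℝ

namespace R0

variable {V : Type*} [NormedAddCommGroup V] [NormedSpace ℝ V]

/-- The multiplication
`(a,x,z)·(a',x',z') = (a+a', e^{-a'}x+x', e^{-2a'}z+z'+½ Ω(x,x') e^{-a'})`. -/
def mul (Ω : LinearMap.BilinForm ℝ V) (g h : R0 V) : R0 V :=
  (g.1 + h.1,
    Real.exp (-h.1) • g.2.1 + h.2.1,
    Real.exp (-2 * h.1) * g.2.2 + h.2.2 + 1 / 2 * Ω g.2.1 h.2.1 * Real.exp (-h.1))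

/-- The inverse of `(a,x,z)` is `(-a, -e^a x, -e^{2a} z)`. -/
def inv (g : R0 V) : R0 V :=
  (-g.1, -(Real.exp g.1 • g.2.1), -(Real.exp (2 * g.1) * g.2.2))

/-- `R₀` is a group (with neutral element `(0,0,0)`). -/
abbrev group (Ω : LinearMap.BilinForm ℝ V) (hΩ : Ω.IsAlt) : Group (R0 V) where
  mul := mul Ω
  one := (0, 0, 0)
  inv := inv
  mul_assoc g h k := by
    change mul Ω (mul Ω g h) k = mul Ω g (mul Ω h k)
    obtain ⟨a, x, z⟩ := g
    obtain ⟨b, y, w⟩ := h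
    obtain ⟨c, t, s⟩ := k
    have e1 : Real.exp (-(b + c)) = Real.exp (-b) * Real.exp (-c) := by
      rw [← Real.exp_add]; ring_nf
    have e2 : Real.exp (-2 * (b + c)) = Real.exp (-2 * b) * Real.exp (-2 * c) := by
      rw [← Real.exp_add]; ring_nf
    have e3 : Real.exp (-2 * c) = Real.exp (-c) * Real.exp (-c) := by
      rw [← Real.exp_add]; ring_nf
    refine Prod.ext ?_ (Prod.ext ?_ ?_)
    · simp [mul, add_assoc]
    · simp only [mul, e1]
      module
    · simp only [mul, e1, e2, e3, map_add, map_smul, LinearMap.add_apply, LinearMap.smul_apply,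
        smul_eq_mul]
      ring
  one_mul g := by
    change mul Ω (0, 0, 0) g = g
    simp [mul]
  mul_one g := by
    change mul Ω g (0, 0, 0) = g
    simp [mul]
  inv_mul_cancel g := by
    change mul Ω (inv g) g = (0, 0, 0)
    obtain ⟨a, x, z⟩ := g
    have e1 : Real.exp (-a) * Real.exp a = 1 := by rw [← Real.exp_add]; simp
    have e2 : Real.exp (-(2 * a)) * Real.exp (2 * a) = 1 := by rw [← Real.exp_add]; simp
    refine Prod.ext ?_ (Prod.ext ?_ ?_)
    · simp [mul, inv]
    · simp [mul, inv, smul_smul, e1]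
    · simp [mul, inv, hΩ.self_eq_zero x, ← mul_assoc, e2]

variable [FiniteDimensional ℝ V] [MeasurableSpace V] [BorelSpace V]

/-- The Lebesgue measure `da dx dz`, a left Haar measure of `R₀`; here `dx` is the
translation-invariant measure `μ` on `V`. -/
def haar (μ : Measure V) : Measure (R0 V) :=
  (volume : Measure ℝ).prod (μ.prod (volume : Measure ℝ))

/-- The measure `da dx dz` is invariant under left translations. -/
theorem measurePreserving_mul_left (Ω : LinearMap.BilinForm ℝ V) (μ : Measure V)
    [μ.IsAddHaarMeasure] (g : R0 V) : MeasurePreserving (mul Ω g) (haar μ) (haar μ) := by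
  have hc : Continuous fun x : V => Ω g.2.1 x := (Ω g.2.1).continuous_of_finiteDimensional
  have hz (a : ℝ) (x : V) : MeasurePreserving (fun z : ℝ =>
      Real.exp (-2 * a) * g.2.2 + z + 1 / 2 * Ω g.2.1 x * Real.exp (-a)) :=
    (measurePreserving_add_right volume _).comp (measurePreserving_add_left volume _)
  have hxz (a : ℝ) : MeasurePreserving (fun p : V × ℝ =>
      (Real.exp (-a) • g.2.1 + p.1,
        Real.exp (-2 * a) * g.2.2 + p.2 + 1 / 2 * Ω g.2.1 p.1 * Real.exp (-a)))
      (μ.prod (volume : Measure ℝ)) (μ.prod (volume : Measure ℝ)) :=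
    MeasurePreserving.skew_product
      (g := fun (x : V) (z : ℝ) =>
        Real.exp (-2 * a) * g.2.2 + z + 1 / 2 * Ω g.2.1 x * Real.exp (-a))
      (measurePreserving_add_left μ _)
      (Continuous.measurable (by unfold Function.uncurry; fun_prop))
      (Filter.Eventually.of_forall fun x => (hz a x).map_eq)
  exact MeasurePreserving.skew_product
    (g := fun (a : ℝ) (p : V × ℝ) => (Real.exp (-a) • g.2.1 + p.1,
        Real.exp (-2 * a) * g.2.2 + p.2 + 1 / 2 * Ω g.2.1 p.1 * Real.exp (-a)))
    (measurePreserving_add_left volume g.1)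
    (Continuous.measurable (by unfold Function.uncurry; fun_prop))
    (Filter.Eventually.of_forall fun a => (hxz a).map_eq)

/-- The Hilbert space `L²(R₀)` of complex-valued square integrable functions. -/
abbrev L2 (μ : Measure V) : Type _ := Lp ℂ 2 (haar μ)

/-- The left regular representation `(λ_g u)(h) = u(g⁻¹ h)` on `L²(R₀)`. -/
def leftRegular (Ω : LinearMap.BilinForm ℝ V) (μ : Measure V) [μ.IsAddHaarMeasure]
    (g : R0 V) : L2 μ →ₗᵢ[ℂ] L2 μ :=
  Lp.compMeasurePreservingₗᵢ ℂ (mul Ω (inv g)) (measurePreserving_mul_left Ω μ (inv g))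

/-- The space `L²(R₀)^∞` of smooth vectors of the left regular representation: those `u` whose
orbit map `g ↦ λ_g u` is a `C^∞` map from `R₀` to `L²(R₀)`. -/
def smoothVectors (Ω : LinearMap.BilinForm ℝ V) (μ : Measure V) [μ.IsAddHaarMeasure] :
    Submodule ℂ (L2 μ) where
  carrier := {u | ContDiff ℝ ((⊤ : ℕ∞) : WithTop ℕ∞) fun g : R0 V => leftRegular Ω μ g u}
  add_mem' := by
    intro u v hu hv
    rw [Set.mem_ofPred_eq] at hu hv ⊢
    simp only [map_add]
    exact hu.add hv
  zero_mem' := by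
    rw [Set.mem_ofPred_eq]
    simp only [map_zero]
    exact contDiff_const
  smul_mem' := by
    intro c u hu
    rw [Set.mem_ofPred_eq] at hu ⊢
    simp only [map_smul]
    exact hu.const_smul c

/-- `S_V(x₀,x₁,x₂) = Ω(x₀,x₁) + Ω(x₁,x₂) + Ω(x₂,x₀)`. -/
def weylPhase (Ω : LinearMap.BilinForm ℝ V) (x₀ x₁ x₂ : V) : ℝ :=
  Ω x₀ x₁ + Ω x₁ x₂ + Ω x₂ x₀

/-- The three-point phase `S`. -/
def phase (Ω : LinearMap.BilinForm ℝ V) : R0 V → R0 V → R0 V → ℝ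
  | (a₀, x₀, z₀), (a₁, x₁, z₁), (a₂, x₂, z₂) =>
    weylPhase Ω (Real.cosh (a₁ - a₂) • x₀) (Real.cosh (a₂ - a₀) • x₁) (Real.cosh (a₀ - a₁) • x₂)
      - (Real.sinh (2 * (a₀ - a₁)) * z₂ + Real.sinh (2 * (a₁ - a₂)) * z₀
        + Real.sinh (2 * (a₂ - a₀)) * z₁)

/-- The three-point amplitude `A`; note `dim R₀ - 2 = dim V`. -/
def amplitude : R0 V → R0 V → R0 V → ℝ
  | (a₀, _, _), (a₁, _, _), (a₂, _, _) =>
    Real.sqrt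
      (Real.cosh (2 * (a₁ - a₂)) * Real.cosh (2 * (a₂ - a₀)) * Real.cosh (2 * (a₀ - a₁))
        * (Real.cosh (a₁ - a₂) * Real.cosh (a₂ - a₀) * Real.cosh (a₀ - a₁))
            ^ Module.finrank ℝ V)

/-- The function
`(u ⋆ v)(g₀) = θ^{-dim R₀} ∫_{R₀×R₀} A e^{(2i/θ) S}(g₀,g₁,g₂) u(g₁) v(g₂) dg₁ dg₂`. -/
def starFormula (Ω : LinearMap.BilinForm ℝ V) (μ : Measure V) (θ : ℝ) (u v : R0 V → ℂ)
    (g₀ : R0 V) : ℂ :=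
  1 / (θ : ℂ) ^ Module.finrank ℝ (R0 V) *
    ∫ p : R0 V × R0 V,
      (amplitude g₀ p.1 p.2 : ℂ)
        * Complex.exp (2 * Complex.I / (θ : ℂ) * (phase Ω g₀ p.1 p.2 : ℂ))
        * (u p.1 * v p.2) ∂((haar μ).prod (haar μ))

/-- `B` is a continuous bilinear product on `L²(R₀)` which on smooth compactly supported functions
is given by the integral formula. -/
def IsHilbertStarProduct (Ω : LinearMap.BilinForm ℝ V) (μ : Measure V) (θ : ℝ)
    (B : L2 μ →L[ℂ] L2 μ →L[ℂ] L2 μ) : Prop :=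
  ∀ u v : R0 V → ℂ,
    ContDiff ℝ ((⊤ : ℕ∞) : WithTop ℕ∞) u → HasCompactSupport u →
    ContDiff ℝ ((⊤ : ℕ∞) : WithTop ℕ∞) v → HasCompactSupport v →
    ∀ f g : L2 μ, f =ᵐ[haar μ] u → g =ᵐ[haar μ] v →
      B f g =ᵐ[haar μ] starFormula Ω μ θ u v

end R0

end

/-! The product is operator composition in disguise. Choose Darboux coordinates `V ≃ E × E`, so that
points of the group read `((a, q), (p, z))`. To a test function `F` attach the integral operator on
`L²(ℝ × E)` with kernel `quantKernel κ F`, `κ = 2 / θ`: essentially a partial Fourier transform of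
`F` in `(p, z)`, evaluated at the midpoint and at a deformed difference of the two arguments. The
weight in the kernel is chosen so that Plancherel bounds its `L²` norm by a constant times that of
`F` (`exists_lintegral_quantKernel_le`). Hence quantization extends to a bounded map `Q` from `L²`
of the group to Hilbert–Schmidt kernels.

Since the composition of Hilbert–Schmidt kernels is bounded, `(u, v) ↦ Q* (Q u ∘ Q v)` is a
continuous bilinear product. Its matrix coefficient against `w` is the trace of `(Q w)* (Q u) (Q
v)`, an integral over the vertices of a triangle. In the coordinates given by the midpoints of the
sides, the three Fourier phases add up to `S`, and the weights together with the Jacobian give `A`,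
so the trace is a constant multiple of the pairing of `w` with the integral formula
(`R0.exists_integral_star_eq_kernelTriple`). Rescaling by that constant gives existence; neither
unitarity nor invertibility of `Q` is needed.

Uniqueness follows from the density of test functions. Both `S` and `A` are invariant under
simultaneous left translation, so the product commutes with `λ_g`. Thus `λ_g (u ⋆ v) = λ_g u ⋆ λ_g
v` is a bounded bilinear map applied to two smooth orbit maps, and is smooth in `g`. -/

open MeasureTheory

open scoped ENNReal NNReal FourierTransform

set_option linter.unusedSectionVars false

/-! ### Linear changes of variables between Haar measures -/

section LinearChangeOfVariables

variable {F G : Type*} [NormedAddCommGroup F] [NormedSpace ℝ F] [FiniteDimensional ℝ F]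
  [MeasurableSpace F] [BorelSpace F] [NormedAddCommGroup G] [NormedSpace ℝ G]
  [FiniteDimensional ℝ G] [MeasurableSpace G] [BorelSpace G]

/-- A linear isomorphism maps a Lebesgue measure to a positive multiple of any other one. -/
theorem ContinuousLinearEquiv.exists_map_eq_smul_addHaar (e : F ≃L[ℝ] G) (ν : Measure F)
    (ν' : Measure G) [ν.IsAddHaarMeasure] [ν'.IsAddHaarMeasure] :
    ∃ c : ℝ≥0, c ≠ 0 ∧ ν.map e = c • ν' := by
  have : (ν.map e).IsAddHaarMeasure := e.isAddHaarMeasure_map ν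
  refine ⟨(ν.map e).addHaarScalarFactor ν', ?_, Measure.isAddLeftInvariant_eq_smul _ _⟩
  exact (Measure.addHaarScalarFactor_pos_of_isAddHaarMeasure _ _).ne'

theorem ContinuousLinearEquiv.exists_lintegral_comp_eq (e : F ≃L[ℝ] G) (ν : Measure F)
    (ν' : Measure G) [ν.IsAddHaarMeasure] [ν'.IsAddHaarMeasure] :
    ∃ c : ℝ≥0, ∀ f : G → ℝ≥0∞, ∫⁻ x, f (e x) ∂ν = c * ∫⁻ y, f y ∂ν' := by
  obtain ⟨c, -, hc⟩ := e.exists_map_eq_smul_addHaar ν ν'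
  refine ⟨c, fun f => ?_⟩
  have h := lintegral_map_equiv (μ := ν) f e.toHomeomorph.toMeasurableEquiv
  change ∫⁻ y, f y ∂(ν.map e) = ∫⁻ x, f (e x) ∂ν at h
  rw [← h, hc, lintegral_smul_measure]
  rfl

theorem ContinuousLinearEquiv.exists_integral_comp_eq (e : F ≃L[ℝ] G) (ν : Measure F)
    (ν' : Measure G) [ν.IsAddHaarMeasure] [ν'.IsAddHaarMeasure] :
    ∃ c : ℂ, c ≠ 0 ∧ ∀ f : G → ℂ, ∫ x, f (e x) ∂ν = c * ∫ y, f y ∂ν' := by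
  obtain ⟨c, h0, hc⟩ := e.exists_map_eq_smul_addHaar ν ν'
  refine ⟨c, by exact_mod_cast h0, fun f => ?_⟩
  have h := integral_map_equiv (μ := ν) e.toHomeomorph.toMeasurableEquiv f
  change ∫ y, f y ∂(ν.map e) = ∫ x, f (e x) ∂ν at h
  rw [← h, hc, integral_smul_nnreal_measure, NNReal.smul_def, Complex.real_smul]

theorem ContinuousLinearEquiv.integrable_comp_addHaar_iff (e : F ≃L[ℝ] G) (ν : Measure F)
    (ν' : Measure G) [ν.IsAddHaarMeasure] [ν'.IsAddHaarMeasure] (f : G → ℂ) :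
    Integrable (fun x => f (e x)) ν ↔ Integrable f ν' := by
  obtain ⟨c, h0, hc⟩ := e.exists_map_eq_smul_addHaar ν ν'
  have h := integrable_map_equiv (μ := ν) e.toHomeomorph.toMeasurableEquiv f
  change Integrable f (ν.map e) ↔ Integrable (fun x => f (e x)) ν at h
  rw [← h, hc]
  exact integrable_smul_measure (c := (c : ℝ≥0∞)) (by simpa using h0) (by simp)

end LinearChangeOfVariables

/-! ### Lagrangian subspaces and Darboux coordinates -/

namespace LinearMap.BilinForm

variable {V : Type*} [AddCommGroup V] [Module ℝ V] [FiniteDimensional ℝ V]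

/-- An alternating form has a subspace that equals its own orthogonal complement. -/
theorem exists_lagrangian (Ω : LinearMap.BilinForm ℝ V) (hΩ : Ω.IsAlt) :
    ∃ L : Submodule ℝ V, ∀ v, v ∈ L ↔ ∀ w ∈ L, Ω w v = 0 := by
  obtain ⟨L, hL⟩ := exists_maximal_of_wellFoundedGT
    (fun L : Submodule ℝ V => ∀ v ∈ L, ∀ w ∈ L, Ω w v = 0) ⟨⊥, by simp⟩
  refine ⟨L, fun v => ⟨fun hv => hL.prop v hv, fun hv => ?_⟩⟩
  have hle : L ≤ L ⊔ Submodule.span ℝ {v} := le_sup_left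
  -- `L` is maximal isotropic; adjoining a vector orthogonal to `L` keeps it isotropic, so the
  -- vector already lies in `L`.
  refine hL.le_of_ge ?_ hle (Submodule.mem_sup_right (Submodule.mem_span_singleton_self v))
  intro x hx y hy
  obtain ⟨p, hp, s, hs, rfl⟩ := Submodule.mem_sup.1 hx
  obtain ⟨q, hq, t, ht, rfl⟩ := Submodule.mem_sup.1 hy
  obtain ⟨s, rfl⟩ := Submodule.mem_span_singleton.1 hs
  obtain ⟨t, rfl⟩ := Submodule.mem_span_singleton.1 ht
  have h1 : Ω v p = 0 := by rw [← hΩ.neg_eq, hv p hp, neg_zero]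
  simp [hL.prop p hp q hq, hv q hq, h1, hΩ.self_eq_zero v]

/-- Every symplectic vector space has linear coordinates `(q, p)` in which the form is
`⟨q, p'⟩ - ⟨q', p⟩`. -/
theorem exists_darboux (Ω : LinearMap.BilinForm ℝ V) (hΩ : Ω.IsAlt) (hΩ' : Ω.Nondegenerate) :
    ∃ (n : ℕ) (e : V ≃ₗ[ℝ] EuclideanSpace ℝ (Fin n) × EuclideanSpace ℝ (Fin n)),
      ∀ x y, Ω x y = inner ℝ (e x).1 (e y).2 - inner ℝ (e y).1 (e x).2 := by
  obtain ⟨L, hL⟩ := exists_lagrangian Ω hΩ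
  obtain ⟨K, hK⟩ := L.exists_isCompl
  set n := Module.finrank ℝ K with hn
  let φ : K ≃ₗ[ℝ] EuclideanSpace ℝ (Fin n) := LinearEquiv.ofFinrankEq _ _ (by simp [hn])
  let π : V →ₗ[ℝ] K := K.projectionOnto L hK.symm
  have hπ (x : V) : x - π x ∈ L := by
    have h := Submodule.projection_add_projection_eq_self hK.symm x
    have : x - (π x : V) = L.projection K hK x := by
      rw [sub_eq_iff_eq_add']
      exact h.symm
    rw [this]
    exact Submodule.projection_apply_mem _ _
  have hsub (x y : V) : Ω (x - π x) (y - π y) = 0 := (hL _).1 (hπ y) _ (hπ x)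
  let D := (InnerProductSpace.toDual ℝ (EuclideanSpace ℝ (Fin n))).symm
  -- the momentum functional `q ↦ Ω q (v - π v / 2)`
  let m : V →ₗ[ℝ] EuclideanSpace ℝ (Fin n) →ₗ[ℝ] ℝ :=
    Ω.flip.compl₂ ((K.subtype).comp φ.symm.toLinearMap) ∘ₗ
      (LinearMap.id - (1 / 2 : ℝ) • (K.subtype.comp π))
  let p : V →ₗ[ℝ] EuclideanSpace ℝ (Fin n) :=
    D.toLinearEquiv.toLinearMap ∘ₗ LinearMap.toContinuousLinearMap.toLinearMap ∘ₗ m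
  have hp (x y : V) : inner ℝ (φ (π x)) (p y) = Ω (π x) y - 1 / 2 * Ω (π x) (π y) := by
    rw [real_inner_comm]
    change inner ℝ (D (LinearMap.toContinuousLinearMap (m y))) _ = _
    rw [InnerProductSpace.toDual_symm_apply]
    simp [m, LinearMap.compl₂]
  let e₀ : V →ₗ[ℝ] EuclideanSpace ℝ (Fin n) × EuclideanSpace ℝ (Fin n) :=
    (φ.toLinearMap ∘ₗ π).prod p
  -- The complement `K` need not be isotropic. The halves in the two momenta together supply the
  -- term `-Ω (π x) (π y)` that appears when the vanishing of `Ω` on the `L`-components is expanded.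
  have he (x y : V) : Ω x y = inner ℝ (e₀ x).1 (e₀ y).2 - inner ℝ (e₀ y).1 (e₀ x).2 := by
    have h1 := hsub x y
    have h2 : Ω x (π y) = -Ω (π y) x := (hΩ.neg_eq _ _).symm
    have h3 : Ω (π y) (π x) = -Ω (π x) (π y) := (hΩ.neg_eq _ _).symm
    simp only [map_sub, LinearMap.sub_apply, h2] at h1
    change _ = inner ℝ (φ (π x)) (p y) - inner ℝ (φ (π y)) (p x)
    rw [hp, hp, h3]
    linarith
  have hinj : Function.Injective e₀ := by
    rw [← LinearMap.ker_eq_bot, LinearMap.ker_eq_bot']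
    intro x hx
    refine hΩ'.1 x fun y => ?_
    rw [he, hx]
    simp
  -- `Ω` pairs `K` injectively into the dual of `L`: a vector of `K` that annihilates `L` lies in
  -- `L`, hence is zero. So `dim V = dim K + dim L ≥ 2 dim K`, the bound opposite to injectivity of
  -- `e₀`.
  have hK' : Module.finrank ℝ K ≤ Module.finrank ℝ L := by
    rw [← Subspace.dual_finrank_eq (V := L)]
    refine LinearMap.finrank_le_finrank_of_injective
      (f := (LinearMap.lcomp ℝ ℝ L.subtype ∘ₗ Ω) ∘ₗ K.subtype) ?_
    rw [← LinearMap.ker_eq_bot, LinearMap.ker_eq_bot']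
    intro q hq
    have hqL : (q : V) ∈ L := (hL _).2 fun w hw => by
      rw [← hΩ.neg_eq, neg_eq_zero]
      exact LinearMap.congr_fun hq ⟨w, hw⟩
    exact Subtype.ext ((Submodule.disjoint_def.1 hK.disjoint) _ hqL q.2)
  have hdim : Module.finrank ℝ V =
      Module.finrank ℝ (EuclideanSpace ℝ (Fin n) × EuclideanSpace ℝ (Fin n)) := by
    refine le_antisymm (LinearMap.finrank_le_finrank_of_injective hinj) ?_
    rw [← Submodule.finrank_add_eq_of_isCompl hK, Module.finrank_prod, finrank_euclideanSpace_fin]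
    omega
  exact ⟨n, LinearMap.linearEquivOfInjective e₀ hinj hdim, he⟩

end LinearMap.BilinForm

/-! ### Square norms and the Plancherel inequality -/

theorem MeasureTheory.eLpNorm_two_sq_eq_lintegral {α F : Type*} [MeasurableSpace α]
    [NormedAddCommGroup F] (f : α → F) (ν : Measure α) :
    eLpNorm f 2 ν ^ 2 = ∫⁻ x, ‖f x‖ₑ ^ 2 ∂ν := by
  have h := eLpNorm_nnreal_pow_eq_lintegral (f := f) (μ := ν) (p := 2) two_ne_zero
  have h2 : ((2 : ℝ≥0) : ℝ) = ((2 : ℕ) : ℝ) := by norm_num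
  simpa only [h2, ENNReal.rpow_natCast, ENNReal.coe_ofNat] using h

section Plancherel

variable {E : Type*} [NormedAddCommGroup E] [InnerProductSpace ℝ E] [FiniteDimensional ℝ E]
  [MeasurableSpace E] [BorelSpace E]

theorem SchwartzMap.lintegral_enorm_sq_fourier (f : SchwartzMap E ℂ) :
    ∫⁻ ξ, ‖𝓕 (f : E → ℂ) ξ‖ₑ ^ 2 = ∫⁻ x, ‖f x‖ₑ ^ 2 := by
  have h : ‖(𝓕 f).toLp 2‖ₑ = ‖f.toLp 2‖ₑ := by
    rw [← ofReal_norm, norm_fourier_toL2_eq, ofReal_norm]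
  rw [Lp.enorm_def, Lp.enorm_def, eLpNorm_congr_ae ((𝓕 f).coeFn_toLp 2 volume),
    eLpNorm_congr_ae (f.coeFn_toLp 2 volume)] at h
  rw [← eLpNorm_two_sq_eq_lintegral, ← eLpNorm_two_sq_eq_lintegral, ← fourier_coe, h]

/-- Plancherel's inequality on `E × ℝ`, for an arbitrary normalization of the pairing. -/
theorem exists_lintegral_fourier_prod_le {κ : ℝ} (hκ : κ ≠ 0) :
    ∃ C : ℝ≥0, ∀ F : E × ℝ → ℂ, ContDiff ℝ ((⊤ : ℕ∞) : WithTop ℕ∞) F → HasCompactSupport F →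
      ∫⁻ η : E × ℝ,
        ‖∫ y : E × ℝ, Complex.exp ((κ * (inner ℝ η.1 y.1 + η.2 * y.2) : ℝ) * Complex.I) * F y‖ₑ ^ 2
        ≤ C * ∫⁻ y, ‖F y‖ₑ ^ 2 := by
  have : (volume : Measure (E × ℝ)).IsAddHaarMeasure := Measure.prod.instIsAddHaarMeasure _ _
  let ι := WithLp.prodContinuousLinearEquiv 2 ℝ E ℝ
  -- Dilating by `-κ / (2π)` turns the character `exp (-2πi⟨y, ·⟩)` of `𝓕` into `exp (iκ⟨·, y⟩)`.
  -- `WithLp 2` is there because the product norm on `E × ℝ` is not Euclidean.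
  have hs : -(κ / (2 * Real.pi)) ≠ 0 := neg_ne_zero.2 (div_ne_zero hκ (by positivity))
  let e : (E × ℝ) ≃L[ℝ] WithLp 2 (E × ℝ) :=
    (ContinuousLinearEquiv.smulLeft (Units.mk0 _ hs)).trans ι.symm
  obtain ⟨C, hC⟩ := e.exists_lintegral_comp_eq volume volume
  refine ⟨C, fun F hF hF' => ?_⟩
  have hsupp : HasCompactSupport (F ∘ ι) := hF'.comp_homeomorph ι.toHomeomorph
  let f : SchwartzMap (WithLp 2 (E × ℝ)) ℂ :=
    hsupp.toSchwartzMap (hF.comp ι.contDiff)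
  have hmp := WithLp.volume_preserving_toLp E ℝ
  have hemb : MeasurableEmbedding (WithLp.toLp 2 : E × ℝ → WithLp 2 (E × ℝ)) :=
    ι.symm.toHomeomorph.measurableEmbedding
  have key (η : E × ℝ) : 𝓕 (f : WithLp 2 (E × ℝ) → ℂ) (e η) = ∫ y : E × ℝ,
      Complex.exp ((κ * (inner ℝ η.1 y.1 + η.2 * y.2) : ℝ) * Complex.I) * F y := by
    rw [Real.fourier_eq', ← hmp.integral_comp hemb]
    refine integral_congr_ae (Filter.Eventually.of_forall fun y => ?_)
    change _ • F y = _
    rw [smul_eq_mul]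
    congr 3
    have : e η = WithLp.toLp 2 (-(κ / (2 * Real.pi)) • η) := rfl
    rw [this, WithLp.prod_inner_apply]
    simp only [Prod.smul_fst, Prod.smul_snd, inner_smul_right, real_inner_comm]
    simp
    field_simp
    ring
  simp_rw [← key]
  rw [hC fun w => ‖𝓕 (f : WithLp 2 (E × ℝ) → ℂ) w‖ₑ ^ 2, f.lintegral_enorm_sq_fourier,
    ← hmp.lintegral_comp_emb hemb]
  rfl

end Plancherel

/-! ### Composition of Hilbert–Schmidt kernels -/

section HilbertSchmidt

variable {α : Type*} [MeasurableSpace α] {ν : Measure α} [SigmaFinite ν]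

theorem ENNReal.sq_lintegral_mul_le {α : Type*} [MeasurableSpace α] {ν : Measure α}
    {f g : α → ℝ≥0∞} (hf : AEMeasurable f ν)
    (hg : AEMeasurable g ν) :
    (∫⁻ x, f x * g x ∂ν) ^ 2 ≤ (∫⁻ x, f x ^ 2 ∂ν) * ∫⁻ x, g x ^ 2 ∂ν := by
  have h := ENNReal.lintegral_mul_le_Lp_mul_Lq ν Real.HolderConjugate.two_two hf hg
  have h2 (a : ℝ≥0∞) : a ^ (2 : ℝ) = a ^ 2 := by
    rw [← ENNReal.rpow_natCast]; norm_num
  have h3 (a : ℝ≥0∞) : (a ^ (1 / 2 : ℝ)) ^ 2 = a := by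
    rw [← ENNReal.rpow_natCast, ← ENNReal.rpow_mul]; norm_num
  calc (∫⁻ x, f x * g x ∂ν) ^ 2
      ≤ ((∫⁻ x, f x ^ (2 : ℝ) ∂ν) ^ (1 / 2 : ℝ) * (∫⁻ x, g x ^ (2 : ℝ) ∂ν) ^ (1 / 2 : ℝ)) ^ 2 := by
        gcongr; exact h
    _ = _ := by rw [mul_pow, h3, h3]; simp_rw [h2]

/-- The composition of integral kernels is bounded by the product of Hilbert–Schmidt norms. -/
theorem lintegral_sq_comp_kernel_le {l m : α × α → ℝ≥0∞} (hl : Measurable l) (hm : Measurable m) :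
    ∫⁻ x : α × α, (∫⁻ r, l (x.1, r) * m (r, x.2) ∂ν) ^ 2 ∂(ν.prod ν) ≤
      (∫⁻ x, l x ^ 2 ∂(ν.prod ν)) * ∫⁻ x, m x ^ 2 ∂(ν.prod ν) := by
  calc ∫⁻ x : α × α, (∫⁻ r, l (x.1, r) * m (r, x.2) ∂ν) ^ 2 ∂(ν.prod ν)
      ≤ ∫⁻ x : α × α, (∫⁻ r, l (x.1, r) ^ 2 ∂ν) * (∫⁻ r, m (r, x.2) ^ 2 ∂ν) ∂(ν.prod ν) :=
        -- Cauchy–Schwarz in `r` separates the dependence on the two outer variables, so the double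
        -- integral factors.
        lintegral_mono fun x => ENNReal.sq_lintegral_mul_le
          (hl.comp measurable_prodMk_left).aemeasurable
          (hm.comp measurable_prodMk_right).aemeasurable
    _ = (∫⁻ p, ∫⁻ r, l (p, r) ^ 2 ∂ν ∂ν) * ∫⁻ q, ∫⁻ r, m (r, q) ^ 2 ∂ν ∂ν :=
        lintegral_prod_mul (hl.pow_const 2).lintegral_prod_right'.aemeasurable
          (hm.pow_const 2).lintegral_prod_left'.aemeasurable
    _ = _ := by
        rw [lintegral_prod _ (hl.pow_const 2).aemeasurable,
          lintegral_prod_symm _ (hm.pow_const 2).aemeasurable]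

/-- This and its mirror image pull null sets of pairs back to null sets of triples; they make the
composition of kernels well defined on almost-everywhere classes. -/
theorem quasiMeasurePreserving_left_leg :
    Measure.QuasiMeasurePreserving (fun p : (α × α) × α => (p.1.1, p.2))
      ((ν.prod ν).prod ν) (ν.prod ν) :=
  QuasiMeasurePreserving.prodMap Measure.quasiMeasurePreserving_fst
    (Measure.QuasiMeasurePreserving.id ν)

theorem quasiMeasurePreserving_right_leg :
    Measure.QuasiMeasurePreserving (fun p : (α × α) × α => (p.2, p.1.2))
      ((ν.prod ν).prod ν) (ν.prod ν) :=
  Measure.measurePreserving_swap.quasiMeasurePreserving.comp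
    (QuasiMeasurePreserving.prodMap Measure.quasiMeasurePreserving_snd
      (Measure.QuasiMeasurePreserving.id ν))

theorem MeasureTheory.MemLp.lintegral_enorm_sq_lt_top {β : Type*} [MeasurableSpace β]
    {ρ : Measure β} {f : β → ℂ} (hf : MemLp f 2 ρ) : ∫⁻ x, ‖f x‖ₑ ^ 2 ∂ρ < ∞ := by
  rw [← eLpNorm_two_sq_eq_lintegral]
  exact ENNReal.pow_lt_top hf.eLpNorm_lt_top

/-- The composition of two integral kernels. -/
noncomputable def kernelComp (ν : Measure α) (l m : α × α → ℂ) (x : α × α) : ℂ :=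
  ∫ r, l (x.1, r) * m (r, x.2) ∂ν

/-- The Hilbert–Schmidt bound for the absolute values makes the inner integral finite almost
everywhere. Additivity of the composition rests on this, since Bochner integrals add only where the
integrands are integrable. -/
theorem ae_integrable_kernelComp {l m : α × α → ℂ} (hl : StronglyMeasurable l)
    (hm : StronglyMeasurable m) (hl2 : MemLp l 2 (ν.prod ν)) (hm2 : MemLp m 2 (ν.prod ν)) :
    ∀ᵐ x ∂(ν.prod ν), Integrable (fun r => l (x.1, r) * m (r, x.2)) ν := by
  have h := lintegral_sq_comp_kernel_le (ν := ν) hl.enorm hm.enorm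
  have hmeas : Measurable fun x : α × α => ∫⁻ r, ‖l (x.1, r)‖ₑ * ‖m (r, x.2)‖ₑ ∂ν := by
    refine Measurable.lintegral_prod_right'
      (f := fun p : (α × α) × α => ‖l (p.1.1, p.2)‖ₑ * ‖m (p.2, p.1.2)‖ₑ) ?_
    exact (hl.enorm.comp (by fun_prop)).mul (hm.enorm.comp (by fun_prop))
  have hfin := ae_lt_top (hmeas.pow_const 2) (h.trans_lt (ENNReal.mul_lt_top
    hl2.lintegral_enorm_sq_lt_top hm2.lintegral_enorm_sq_lt_top)).ne
  filter_upwards [hfin] with x hx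
  refine ⟨((hl.comp_measurable measurable_prodMk_left).mul
    (hm.comp_measurable measurable_prodMk_right)).aestronglyMeasurable, ?_⟩
  rw [hasFiniteIntegral_iff_enorm]
  simp_rw [enorm_mul]
  exact (ENNReal.pow_lt_top_iff.1 hx).resolve_right (by simp)

theorem eLpNorm_kernelComp_le {l m : α × α → ℂ} (hl : StronglyMeasurable l)
    (hm : StronglyMeasurable m) :
    eLpNorm (kernelComp ν l m) 2 (ν.prod ν) ≤
      eLpNorm l 2 (ν.prod ν) * eLpNorm m 2 (ν.prod ν) := by
  rw [← ENNReal.pow_le_pow_left_iff two_ne_zero, mul_pow]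
  simp_rw [eLpNorm_two_sq_eq_lintegral]
  refine le_trans (lintegral_mono fun x => ?_)
    (lintegral_sq_comp_kernel_le (ν := ν) hl.enorm hm.enorm)
  gcongr
  refine (enorm_integral_le_lintegral_enorm _).trans_eq ?_
  simp_rw [enorm_mul]

theorem aestronglyMeasurable_kernelComp {l m : α × α → ℂ} (hl : StronglyMeasurable l)
    (hm : StronglyMeasurable m) : AEStronglyMeasurable (kernelComp ν l m) (ν.prod ν) := by
  refine AEStronglyMeasurable.integral_prod_right'
    (f := fun p : (α × α) × α => l (p.1.1, p.2) * m (p.2, p.1.2)) ?_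
  exact ((hl.comp_measurable (by fun_prop)).mul
    (hm.comp_measurable (by fun_prop))).aestronglyMeasurable

theorem memLp_kernelComp (k l : Lp ℂ 2 (ν.prod ν)) : MemLp (kernelComp ν k l) 2 (ν.prod ν) :=
  ⟨aestronglyMeasurable_kernelComp (Lp.stronglyMeasurable k) (Lp.stronglyMeasurable l),
    (eLpNorm_kernelComp_le (Lp.stronglyMeasurable k) (Lp.stronglyMeasurable l)).trans_lt
      (ENNReal.mul_lt_top (Lp.eLpNorm_lt_top k) (Lp.eLpNorm_lt_top l))⟩

/-- Kernels that agree almost everywhere have almost everywhere the same composition integrand. -/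
theorem kernelComp_congr_ae {l l' m m' : α × α → ℂ} (hl : l =ᵐ[ν.prod ν] l')
    (hm : m =ᵐ[ν.prod ν] m') : ∀ᵐ x ∂(ν.prod ν), (fun r => l (x.1, r) * m (r, x.2)) =ᵐ[ν]
      fun r => l' (x.1, r) * m' (r, x.2) := by
  have h1 := quasiMeasurePreserving_left_leg.ae hl
  have h2 := quasiMeasurePreserving_right_leg.ae hm
  filter_upwards [Measure.ae_ae_of_ae_prod h1, Measure.ae_ae_of_ae_prod h2] with x hx hx'
  filter_upwards [hx, hx'] with r hr hr'
  rw [hr, hr']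

/-- Composition of Hilbert–Schmidt kernels as a continuous bilinear map. -/
noncomputable def hilbertSchmidtComp (ν : Measure α) [SigmaFinite ν] :
    Lp ℂ 2 (ν.prod ν) →L[ℂ] Lp ℂ 2 (ν.prod ν) →L[ℂ] Lp ℂ 2 (ν.prod ν) :=
  LinearMap.mkContinuous₂
    (LinearMap.mk₂ ℂ (fun k l => (memLp_kernelComp k l).toLp)
      (fun k k' l => by
        rw [← MemLp.toLp_add, MemLp.toLp_eq_toLp_iff]
        filter_upwards [kernelComp_congr_ae (Lp.coeFn_add k k') (Filter.EventuallyEq.refl _ l),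
          ae_integrable_kernelComp (Lp.stronglyMeasurable k) (Lp.stronglyMeasurable l)
            (Lp.memLp k) (Lp.memLp l),
          ae_integrable_kernelComp (Lp.stronglyMeasurable k') (Lp.stronglyMeasurable l)
            (Lp.memLp k') (Lp.memLp l)] with x hx h1 h2
        simp only [kernelComp, Pi.add_apply]
        rw [integral_congr_ae hx, ← integral_add h1 h2]
        simp only [Pi.add_apply, add_mul])
      (fun c k l => by
        rw [← MemLp.toLp_const_smul, MemLp.toLp_eq_toLp_iff]
        filter_upwards [kernelComp_congr_ae (Lp.coeFn_smul c k) (Filter.EventuallyEq.refl _ l)]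
          with x hx
        simp only [kernelComp, Pi.smul_apply]
        rw [integral_congr_ae hx, ← integral_smul]
        simp only [Pi.smul_apply, smul_mul_assoc])
      (fun k l l' => by
        rw [← MemLp.toLp_add, MemLp.toLp_eq_toLp_iff]
        filter_upwards [kernelComp_congr_ae (Filter.EventuallyEq.refl _ k) (Lp.coeFn_add l l'),
          ae_integrable_kernelComp (Lp.stronglyMeasurable k) (Lp.stronglyMeasurable l)
            (Lp.memLp k) (Lp.memLp l),
          ae_integrable_kernelComp (Lp.stronglyMeasurable k) (Lp.stronglyMeasurable l')
            (Lp.memLp k) (Lp.memLp l')] with x hx h1 h2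
        simp only [kernelComp, Pi.add_apply]
        rw [integral_congr_ae hx, ← integral_add h1 h2]
        simp only [Pi.add_apply, mul_add])
      (fun c k l => by
        rw [← MemLp.toLp_const_smul, MemLp.toLp_eq_toLp_iff]
        filter_upwards [kernelComp_congr_ae (Filter.EventuallyEq.refl _ k) (Lp.coeFn_smul c l)]
          with x hx
        simp only [kernelComp, Pi.smul_apply]
        rw [integral_congr_ae hx, ← integral_smul]
        simp only [Pi.smul_apply, mul_smul_comm]))
    1
    (fun k l => by
      rw [one_mul, LinearMap.mk₂_apply, Lp.norm_toLp, Lp.norm_def, Lp.norm_def,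
        ← ENNReal.toReal_mul]
      exact ENNReal.toReal_mono (ENNReal.mul_lt_top (Lp.eLpNorm_lt_top k) (Lp.eLpNorm_lt_top l)).ne
        (eLpNorm_kernelComp_le (Lp.stronglyMeasurable k) (Lp.stronglyMeasurable l)))

theorem hilbertSchmidtComp_toLp {l m : α × α → ℂ} (hl : MemLp l 2 (ν.prod ν))
    (hm : MemLp m 2 (ν.prod ν)) :
    hilbertSchmidtComp ν hl.toLp hm.toLp =ᵐ[ν.prod ν] kernelComp ν l m := by
  refine (MemLp.coeFn_toLp (memLp_kernelComp hl.toLp hm.toLp)).trans ?_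
  filter_upwards [kernelComp_congr_ae hl.coeFn_toLp hm.coeFn_toLp] with x hx
  exact integral_congr_ae hx

/-- The integrand of `tr (k* l m)` is integrable. -/
theorem integrable_triple_kernel {k l m : α × α → ℂ} (hk : StronglyMeasurable k)
    (hl : StronglyMeasurable l) (hm : StronglyMeasurable m) (hk2 : MemLp k 2 (ν.prod ν))
    (hl2 : MemLp l 2 (ν.prod ν)) (hm2 : MemLp m 2 (ν.prod ν)) :
    Integrable (fun p : (α × α) × α => star (k p.1) * (l (p.1.1, p.2) * m (p.2, p.1.2)))
      ((ν.prod ν).prod ν) := by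
  have hmeas : Measurable fun x : α × α => ∫⁻ r, ‖l (x.1, r)‖ₑ * ‖m (r, x.2)‖ₑ ∂ν := by
    refine Measurable.lintegral_prod_right'
      (f := fun p : (α × α) × α => ‖l (p.1.1, p.2)‖ₑ * ‖m (p.2, p.1.2)‖ₑ) ?_
    exact (hl.enorm.comp (by fun_prop)).mul (hm.enorm.comp (by fun_prop))
  have hsm : StronglyMeasurable
      fun p : (α × α) × α => star (k p.1) * (l (p.1.1, p.2) * m (p.2, p.1.2)) :=
    (continuous_star.comp_stronglyMeasurable (hk.comp_measurable measurable_fst)).mul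
      ((hl.comp_measurable (by fun_prop)).mul (hm.comp_measurable (by fun_prop)))
  refine ⟨hsm.aestronglyMeasurable, ?_⟩
  rw [hasFiniteIntegral_iff_enorm, lintegral_prod _ hsm.enorm.aemeasurable]
  have hmr (x : α × α) : Measurable fun r => ‖l (x.1, r)‖ₑ * ‖m (r, x.2)‖ₑ :=
    (hl.enorm.comp measurable_prodMk_left).mul (hm.enorm.comp measurable_prodMk_right)
  have hstar (z : ℂ) : ‖star z‖ₑ = ‖z‖ₑ := by
    rw [← ofReal_norm, norm_star, ofReal_norm]
  simp_rw [enorm_mul, hstar]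
  have hconst (x : α × α) := lintegral_const_mul (μ := ν) ‖k x‖ₑ (hmr x)
  rw [lintegral_congr hconst]
  have h := ENNReal.sq_lintegral_mul_le (ν := ν.prod ν) hk.enorm.aemeasurable hmeas.aemeasurable
  have hlt := h.trans_lt (ENNReal.mul_lt_top hk2.lintegral_enorm_sq_lt_top
    ((lintegral_sq_comp_kernel_le (ν := ν) hl.enorm hm.enorm).trans_lt (ENNReal.mul_lt_top
      hl2.lintegral_enorm_sq_lt_top hm2.lintegral_enorm_sq_lt_top)))
  exact (ENNReal.pow_lt_top_iff.1 hlt).resolve_right (by simp)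

end HilbertSchmidt

/-! ### The quantization kernel and its `L²` bound -/

section KernelTransform

variable {E : Type*} [NormedAddCommGroup E] [InnerProductSpace ℝ E] [FiniteDimensional ℝ E]
  [MeasurableSpace E] [BorelSpace E]

instance MeasureTheory.Measure.isAddHaarMeasure_volume_prod {A B : Type*} [NormedAddCommGroup A]
    [MeasureSpace A] [BorelSpace A] [NormedAddCommGroup B] [MeasureSpace B] [BorelSpace B]
    [ProperSpace A] [ProperSpace B] [(volume : Measure A).IsAddHaarMeasure]
    [(volume : Measure B).IsAddHaarMeasure] : (volume : Measure (A × B)).IsAddHaarMeasure :=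
  Measure.prod.instIsAddHaarMeasure _ _

/-- The Fourier transform of `F` in the second group of variables. -/
noncomputable def partialFourier (κ : ℝ) (F : (ℝ × E) × (E × ℝ) → ℂ) (b : ℝ × E) (η : E × ℝ) : ℂ :=
  ∫ y : E × ℝ, Complex.exp ((κ * (inner ℝ η.1 y.1 + η.2 * y.2) : ℝ) * Complex.I) * F (b, y)

/-- The integral kernel of the operator quantizing `F`. -/
noncomputable def quantKernel (κ : ℝ) (F : (ℝ × E) × (E × ℝ) → ℂ) (x : (ℝ × E) × (ℝ × E)) : ℂ :=
  (Real.sqrt (Real.cosh (x.1.1 - x.2.1)) : ℂ) *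
    partialFourier κ F
      ((x.1.1 + x.2.1) / 2, (2 * Real.cosh ((x.1.1 - x.2.1) / 2))⁻¹ • (x.1.2 + x.2.2))
      ((Real.cosh ((x.1.1 - x.2.1) / 2) / 2) • (x.1.2 - x.2.2), Real.sinh (x.1.1 - x.2.1))

theorem HasCompactSupport.comp_prodMk {A B : Type*} [TopologicalSpace A] [TopologicalSpace B]
    [T2Space B] {F : A × B → ℂ} (hF : HasCompactSupport F) (a : A) :
    HasCompactSupport fun b => F (a, b) :=
  HasCompactSupport.intro (hF.isCompact.image continuous_snd) fun b hb =>
    image_eq_zero_of_notMem_tsupport fun h => hb ⟨(a, b), h, rfl⟩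

theorem integrable_partialFourier (κ : ℝ) {F : (ℝ × E) × (E × ℝ) → ℂ} (hF : Continuous F)
    (hF' : HasCompactSupport F) (b : ℝ × E) (η : E × ℝ) :
    Integrable fun y : E × ℝ =>
      Complex.exp ((κ * (inner ℝ η.1 y.1 + η.2 * y.2) : ℝ) * Complex.I) * F (b, y) := by
  refine Continuous.integrable_of_hasCompactSupport ?_ (hF'.comp_prodMk b).mul_left
  fun_prop

theorem partialFourier_add (κ : ℝ) {F G : (ℝ × E) × (E × ℝ) → ℂ} (hF : Continuous F)
    (hF' : HasCompactSupport F) (hG : Continuous G) (hG' : HasCompactSupport G) (b : ℝ × E)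
    (η : E × ℝ) :
    partialFourier κ (F + G) b η = partialFourier κ F b η + partialFourier κ G b η := by
  simp only [partialFourier, Pi.add_apply, mul_add (Complex.exp _)]
  exact integral_add (integrable_partialFourier κ hF hF' b η)
    (integrable_partialFourier κ hG hG' b η)

theorem partialFourier_smul (κ : ℝ) (c : ℂ) (F : (ℝ × E) × (E × ℝ) → ℂ) (b : ℝ × E)
    (η : E × ℝ) : partialFourier κ (c • F) b η = c • partialFourier κ F b η := by
  simp only [partialFourier, Pi.smul_apply, ← integral_smul, mul_smul_comm]

theorem quantKernel_add (κ : ℝ) {F G : (ℝ × E) × (E × ℝ) → ℂ} (hF : Continuous F)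
    (hF' : HasCompactSupport F) (hG : Continuous G) (hG' : HasCompactSupport G) :
    quantKernel κ (F + G) = quantKernel κ F + quantKernel κ G := by
  ext x
  simp only [quantKernel, Pi.add_apply, partialFourier_add κ hF hF' hG hG', mul_add]

theorem quantKernel_smul (κ : ℝ) (c : ℂ) (F : (ℝ × E) × (E × ℝ) → ℂ) :
    quantKernel κ (c • F) = c • quantKernel κ F := by
  ext x
  simp only [quantKernel, Pi.smul_apply, partialFourier_smul, mul_smul_comm]

theorem stronglyMeasurable_partialFourier (κ : ℝ) {F : (ℝ × E) × (E × ℝ) → ℂ} (hF : Continuous F) :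
    StronglyMeasurable fun p : (ℝ × E) × (E × ℝ) => partialFourier κ F p.1 p.2 := by
  refine StronglyMeasurable.integral_prod_right'
    (f := fun p : ((ℝ × E) × (E × ℝ)) × (E × ℝ) =>
      Complex.exp ((κ * (inner ℝ p.1.2.1 p.2.1 + p.1.2.2 * p.2.2) : ℝ) * Complex.I)
        * F (p.1.1, p.2)) ?_
  exact Continuous.stronglyMeasurable (by fun_prop)

theorem continuous_cosh_inv_smul :
    Continuous fun x : (ℝ × E) × (ℝ × E) =>
      (2 * Real.cosh ((x.1.1 - x.2.1) / 2))⁻¹ • (x.1.2 + x.2.2) := by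
  refine Continuous.smul (Continuous.inv₀ (by fun_prop) fun x => ?_) (by fun_prop)
  have := Real.cosh_pos ((x.1.1 - x.2.1) / 2)
  positivity

theorem stronglyMeasurable_quantKernel (κ : ℝ) {F : (ℝ × E) × (E × ℝ) → ℂ} (hF : Continuous F) :
    StronglyMeasurable (quantKernel κ F) := by
  have h0 := continuous_cosh_inv_smul (E := E)
  have h1 : Measurable fun x : (ℝ × E) × (ℝ × E) => (((x.1.1 + x.2.1) / 2,
      (2 * Real.cosh ((x.1.1 - x.2.1) / 2))⁻¹ • (x.1.2 + x.2.2)),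
      ((Real.cosh ((x.1.1 - x.2.1) / 2) / 2) • (x.1.2 - x.2.2), Real.sinh (x.1.1 - x.2.1))) :=
    Continuous.measurable (by fun_prop)
  have h2 : StronglyMeasurable fun x : (ℝ × E) × (ℝ × E) =>
      (Real.sqrt (Real.cosh (x.1.1 - x.2.1)) : ℂ) :=
    Continuous.stronglyMeasurable (by fun_prop)
  have h3 := (stronglyMeasurable_partialFourier κ hF).comp_measurable h1
  exact h2.mul h3

theorem lintegral_comp_smul_addHaar (f : E → ℝ≥0∞) {r : ℝ} (hr : 0 < r) :
    ∫⁻ x : E, f (r • x) = ENNReal.ofReal (r ^ Module.finrank ℝ E)⁻¹ * ∫⁻ x : E, f x := by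
  have h := lintegral_map_equiv (μ := (volume : Measure E)) f
    (Homeomorph.smul (Units.mk0 r hr.ne')).toMeasurableEquiv
  change ∫⁻ y, f y ∂(volume.map (r • ·)) = ∫⁻ x, f (r • x) at h
  rw [← h, Measure.map_addHaar_smul _ hr.ne', lintegral_smul_measure, abs_of_pos (by positivity),
    smul_eq_mul]

/-- The substitution `ξ = sinh t`, a bijection of the line with derivative `cosh t`. The squared
weight of `quantKernel` is exactly this Jacobian. -/
theorem lintegral_comp_sinh (f : ℝ → ℝ≥0∞) :
    ∫⁻ t, ENNReal.ofReal (Real.cosh t) * f (Real.sinh t) = ∫⁻ x, f x := by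
  have h := lintegral_image_eq_lintegral_abs_deriv_mul MeasurableSet.univ
    (fun x _ => (Real.hasDerivAt_sinh x).hasDerivWithinAt) Real.sinh_injective.injOn f
  rw [Set.image_univ, Real.sinh_surjective.range_eq] at h
  simpa [abs_of_pos (Real.cosh_pos _)] using h.symm

theorem lintegral_volume_prod₄ {f : ℝ × ℝ × E × E → ℝ≥0∞} (hf : Measurable f) :
    ∫⁻ w, f w = ∫⁻ t, ∫⁻ a, ∫⁻ δ, ∫⁻ s, f (t, a, δ, s) := by
  rw [Measure.volume_eq_prod, lintegral_prod _ hf.aemeasurable]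
  refine lintegral_congr fun t => ?_
  have hf1 : Measurable fun y => f (t, y) := hf.comp measurable_prodMk_left
  rw [Measure.volume_eq_prod, lintegral_prod _ hf1.aemeasurable]
  refine lintegral_congr fun a => ?_
  have hf2 : Measurable fun y => f (t, a, y) := hf1.comp measurable_prodMk_left
  rw [Measure.volume_eq_prod, lintegral_prod _ hf2.aemeasurable]

/-- The coordinates `(t, a, δ, s)` on pairs of points. -/
noncomputable def midpointEquiv (E : Type*) [NormedAddCommGroup E] [InnerProductSpace ℝ E]
    [FiniteDimensional ℝ E] : ((ℝ × E) × (ℝ × E)) ≃L[ℝ] ℝ × ℝ × E × E :=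
  LinearEquiv.toContinuousLinearEquiv
    { toFun := fun x =>
        (x.1.1 - x.2.1, (1 / 2 : ℝ) • (x.1.1 + x.2.1), x.1.2 - x.2.2, x.1.2 + x.2.2)
      invFun := fun w =>
        ((w.2.1 + (1 / 2 : ℝ) • w.1, (1 / 2 : ℝ) • (w.2.2.1 + w.2.2.2)),
          (w.2.1 - (1 / 2 : ℝ) • w.1, (1 / 2 : ℝ) • (w.2.2.2 - w.2.2.1)))
      map_add' := fun x y => by
        refine Prod.ext ?_ (Prod.ext ?_ (Prod.ext ?_ ?_)) <;> simp <;> abel_nf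
        ring
      map_smul' := fun c x => by
        refine Prod.ext ?_ (Prod.ext ?_ (Prod.ext ?_ ?_)) <;> simp [smul_sub]
        all_goals ring
      left_inv := fun x => by
        refine Prod.ext (Prod.ext ?_ ?_) (Prod.ext ?_ ?_) <;> dsimp only [smul_eq_mul]
        · ring
        · module
        · ring
        · module
      right_inv := fun w => by
        refine Prod.ext ?_ (Prod.ext ?_ (Prod.ext ?_ ?_)) <;> dsimp only [smul_eq_mul]
        · ring
        · ring
        · module
        · module }

/-- The reordering `(ξ, a, δ, q) ↦ ((a, q), (δ, ξ))`. -/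
noncomputable def reorderEquiv (E : Type*) [NormedAddCommGroup E] [InnerProductSpace ℝ E]
    [FiniteDimensional ℝ E] : (ℝ × ℝ × E × E) ≃L[ℝ] (ℝ × E) × (E × ℝ) :=
  LinearEquiv.toContinuousLinearEquiv
    { toFun := fun w => ((w.2.1, w.2.2.2), (w.2.2.1, w.1))
      invFun := fun x => (x.2.2, x.1.1, x.2.1, x.1.2)
      map_add' := fun _ _ => rfl
      map_smul' := fun _ _ => rfl
      left_inv := fun _ => rfl
      right_inv := fun _ => rfl }

/-- In midpoint and difference coordinates the arguments of the partial Fourier transform become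
free variables, with total Jacobian cancelling the weight up to a constant. Plancherel in `(p, z)`
for each fixed `(a, q)` then finishes. -/
theorem exists_lintegral_quantKernel_le {κ : ℝ} (hκ : κ ≠ 0) :
    ∃ C : ℝ≥0, ∀ F : (ℝ × E) × (E × ℝ) → ℂ, ContDiff ℝ ((⊤ : ℕ∞) : WithTop ℕ∞) F →
      HasCompactSupport F →
        ∫⁻ x, ‖quantKernel κ F x‖ₑ ^ 2 ≤ C * ∫⁻ x, ‖F x‖ₑ ^ 2 := by
  obtain ⟨C₁, h₁⟩ := (midpointEquiv E).exists_lintegral_comp_eq volume volume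
  obtain ⟨C₂, h₂⟩ := (reorderEquiv E).exists_lintegral_comp_eq volume volume
  obtain ⟨C₃, h₃⟩ := exists_lintegral_fourier_prod_le (E := E) hκ
  set n := Module.finrank ℝ E with hn
  refine ⟨C₁ * 4 ^ n * C₂ * C₃, fun F hF hF' => ?_⟩
  have hG : Measurable fun p : (ℝ × E) × (E × ℝ) => ‖partialFourier κ F p.1 p.2‖ₑ ^ 2 :=
    (stronglyMeasurable_partialFourier κ hF.continuous).enorm.pow_const 2
  set G : (ℝ × E) × (E × ℝ) → ℝ≥0∞ := fun p => ‖partialFourier κ F p.1 p.2‖ₑ ^ 2 with hGdef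
  let Φ : ℝ × ℝ × E × E → ℝ≥0∞ := fun w => ENNReal.ofReal (Real.cosh w.1) *
    G ((w.2.1, (2 * Real.cosh (w.1 / 2))⁻¹ • w.2.2.2),
      ((Real.cosh (w.1 / 2) / 2) • w.2.2.1, Real.sinh w.1))
  have hΦ : Measurable Φ := by
    refine Measurable.mul (by fun_prop) (hG.comp (Continuous.measurable ?_))
    have : Continuous fun w : ℝ × ℝ × E × E => (2 * Real.cosh (w.1 / 2))⁻¹ • w.2.2.2 := by
      refine Continuous.smul (Continuous.inv₀ (by fun_prop) fun w => ?_) (by fun_prop)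
      have := Real.cosh_pos (w.1 / 2)
      positivity
    fun_prop
  have hK (x : (ℝ × E) × (ℝ × E)) : ‖quantKernel κ F x‖ₑ ^ 2 = Φ (midpointEquiv E x) := by
    have h2 : ‖((Real.sqrt (Real.cosh (x.1.1 - x.2.1)) : ℝ) : ℂ)‖ₑ ^ 2 =
        ENNReal.ofReal (Real.cosh (x.1.1 - x.2.1)) := by
      rw [← ofReal_norm, ← ENNReal.ofReal_pow (norm_nonneg _), Complex.norm_real, Real.norm_eq_abs,
        sq_abs, Real.sq_sqrt (Real.cosh_pos _).le]
    have h3 : midpointEquiv E x = (x.1.1 - x.2.1, (1 / 2 : ℝ) • (x.1.1 + x.2.1), x.1.2 - x.2.2,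
      x.1.2 + x.2.2) := rfl
    rw [h3, quantKernel, enorm_mul, mul_pow, h2]
    simp only [Φ, hGdef, smul_eq_mul]
    rw [show (x.1.1 + x.2.1) / 2 = 1 / 2 * (x.1.1 + x.2.1) by ring]
  -- The dilations by `1 / (2 cosh (t / 2))` and `cosh (t / 2) / 2` have product `1 / 4`, so the two
  -- Jacobians combine to `4 ^ n`, independent of `t`.
  have hscale (t a : ℝ) : ∫⁻ δ : E, ∫⁻ s : E, G ((a, (2 * Real.cosh (t / 2))⁻¹ • s),
      ((Real.cosh (t / 2) / 2) • δ, Real.sinh t)) =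
      4 ^ n * ∫⁻ δ : E, ∫⁻ q : E, G ((a, q), (δ, Real.sinh t)) := by
    have hc := Real.cosh_pos (t / 2)
    have hi (δ : E) := lintegral_comp_smul_addHaar
      (fun q => G ((a, q), ((Real.cosh (t / 2) / 2) • δ, Real.sinh t)))
      (r := (2 * Real.cosh (t / 2))⁻¹) (by positivity)
    simp_rw [hi]
    rw [lintegral_const_mul' _ _ ENNReal.ofReal_ne_top, lintegral_comp_smul_addHaar
      (fun δ => ∫⁻ q : E, G ((a, q), (δ, Real.sinh t))) (r := Real.cosh (t / 2) / 2)
      (by positivity), ← mul_assoc, ← ENNReal.ofReal_mul (by positivity)]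
    congr 1
    rw [← mul_inv, ← mul_pow, ← inv_pow, ENNReal.ofReal_pow (by positivity)]
    congr 1
    rw [show ((2 * Real.cosh (t / 2))⁻¹ * (Real.cosh (t / 2) / 2))⁻¹ = 4 by field_simp; norm_num]
    norm_num
  calc ∫⁻ x, ‖quantKernel κ F x‖ₑ ^ 2
      = C₁ * ∫⁻ w, Φ w := by simp_rw [hK]; exact h₁ Φ
    _ = C₁ * ∫⁻ t, ∫⁻ a, ∫⁻ δ, ∫⁻ s, Φ (t, a, δ, s) := by
        rw [lintegral_volume_prod₄ hΦ]
    _ = C₁ * ∫⁻ t, ENNReal.ofReal (Real.cosh t) *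
          (4 ^ n * ∫⁻ a, ∫⁻ δ, ∫⁻ q, G ((a, q), (δ, Real.sinh t))) := by
        congr 1
        refine lintegral_congr fun t => ?_
        simp only [Φ]
        have e1 (a : ℝ) : ∫⁻ δ : E, ∫⁻ s : E, ENNReal.ofReal (Real.cosh t) *
            G ((a, (2 * Real.cosh (t / 2))⁻¹ • s),
              ((Real.cosh (t / 2) / 2) • δ, Real.sinh t)) =
            ENNReal.ofReal (Real.cosh t) *
              (4 ^ n * ∫⁻ δ : E, ∫⁻ q : E, G ((a, q), (δ, Real.sinh t))) := by
          simp_rw [lintegral_const_mul' _ _ ENNReal.ofReal_ne_top]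
          rw [hscale]
        simp_rw [e1]
        rw [lintegral_const_mul' _ _ ENNReal.ofReal_ne_top, lintegral_const_mul' _ _ (by simp)]
    _ = C₁ * (4 ^ n * ∫⁻ ξ, ∫⁻ a, ∫⁻ δ, ∫⁻ q, G ((a, q), (δ, ξ))) := by
        congr 1
        rw [lintegral_comp_sinh (fun ξ => 4 ^ n * ∫⁻ a, ∫⁻ δ, ∫⁻ q, G ((a, q), (δ, ξ))),
          lintegral_const_mul' _ _ (by simp)]
    _ = C₁ * (4 ^ n * ∫⁻ w : ℝ × ℝ × E × E, G (reorderEquiv E w)) := by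
        have hm : Measurable fun w => G (reorderEquiv E w) :=
          hG.comp (reorderEquiv E).continuous.measurable
        rw [lintegral_volume_prod₄ hm]
        rfl
    _ = C₁ * (4 ^ n * (C₂ * ∫⁻ b, ∫⁻ η, G (b, η))) := by
        rw [h₂, Measure.volume_eq_prod (ℝ × E) (E × ℝ), lintegral_prod _ hG.aemeasurable]
    _ ≤ C₁ * (4 ^ n * (C₂ * ∫⁻ b, C₃ * ∫⁻ y, ‖F (b, y)‖ₑ ^ 2)) := by
        gcongr with b
        exact h₃ (fun y => F (b, y)) (hF.comp (contDiff_const.prodMk contDiff_id))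
          (hF'.comp_prodMk b)
    _ = _ := by
        rw [lintegral_const_mul' _ _ (by simp), Measure.volume_eq_prod (ℝ × E) (E × ℝ),
          lintegral_prod _ (hF.continuous.measurable.enorm.pow_const 2).aemeasurable]
        push_cast
        ring

end KernelTransform

/-! ### The trace of three kernels in midpoint coordinates -/

section TripleProduct

variable {E : Type*} [NormedAddCommGroup E] [InnerProductSpace ℝ E] [FiniteDimensional ℝ E]
  [MeasurableSpace E] [BorelSpace E]

/-- The form used for triangles: midpoint `(a, s)` and half-difference `(t, δ)` of the two
arguments. The dilation `q = s / cosh t` is what later produces the powers of `cosh` in the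
amplitude. -/
theorem quantKernel_midpoint (κ : ℝ) (F : (ℝ × E) × (E × ℝ) → ℂ) (a t : ℝ) (s δ : E) :
    quantKernel κ F ((a + t, s + δ), (a - t, s - δ)) =
      (Real.sqrt (Real.cosh (2 * t)) : ℂ) *
        ∫ y : E × ℝ, Complex.exp
          ((κ * (Real.cosh t * inner ℝ δ y.1 + Real.sinh (2 * t) * y.2) : ℝ) * Complex.I) *
            F ((a, (Real.cosh t)⁻¹ • s), y) := by
  have h1 : (a + t) - (a - t) = 2 * t := by ring
  have h2 : ((a + t) + (a - t)) / 2 = a := by ring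
  have h3 : (2 * Real.cosh t)⁻¹ • (s + δ + (s - δ)) = (Real.cosh t)⁻¹ • s := by
    rw [mul_inv, show s + δ + (s - δ) = (2 : ℝ) • s by module, smul_smul]
    congr 1
    ring
  have h4 : (Real.cosh t / 2) • (s + δ - (s - δ)) = Real.cosh t • δ := by module
  simp only [quantKernel, partialFourier, h1, h2, mul_div_cancel_left₀ t (two_ne_zero' ℝ), h3, h4,
    real_inner_smul_left]

/-- The phase of the product in Darboux coordinates. -/
noncomputable def darbouxPhase (a : ℝ × ℝ × ℝ) (s : E × E × E)
    (y : (E × ℝ) × (E × ℝ) × (E × ℝ)) : ℝ :=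
  -(Real.cosh (a.2.1 - a.2.2) * inner ℝ (s.2.1 - s.2.2) y.1.1
      + Real.sinh (2 * (a.2.1 - a.2.2)) * y.1.2)
    + (Real.cosh (a.1 - a.2.2) * inner ℝ (s.1 - s.2.2) y.2.1.1
      + Real.sinh (2 * (a.1 - a.2.2)) * y.2.1.2)
    + (Real.cosh (a.2.1 - a.1) * inner ℝ (s.2.1 - s.1) y.2.2.1
      + Real.sinh (2 * (a.2.1 - a.1)) * y.2.2.2)

/-- The integrand of the trace of a product of three quantization kernels. -/
noncomputable def kernelTriple (κ : ℝ) (F₀ F₁ F₂ : (ℝ × E) × (E × ℝ) → ℂ)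
    (p : ((ℝ × E) × (ℝ × E)) × (ℝ × E)) : ℂ :=
  star (quantKernel κ F₀ p.1) *
    (quantKernel κ F₁ (p.1.1, p.2) * quantKernel κ F₂ (p.2, p.1.2))

/-- The vertices `((P, Q), R)` of the triangle with midpoints `(a, s)` of its sides. -/
noncomputable def vertexEquiv (E : Type*) [NormedAddCommGroup E] [InnerProductSpace ℝ E]
    [FiniteDimensional ℝ E] :
    ((ℝ × ℝ × ℝ) × (E × E × E)) ≃L[ℝ] ((ℝ × E) × (ℝ × E)) × (ℝ × E) :=
  LinearEquiv.toContinuousLinearEquiv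
    { toFun := fun w =>
        (((w.1.1 + (w.1.2.1 - w.1.2.2), w.2.1 + (w.2.2.1 - w.2.2.2)),
          (w.1.1 - (w.1.2.1 - w.1.2.2), w.2.1 - (w.2.2.1 - w.2.2.2))),
          (w.1.2.1 - (w.1.1 - w.1.2.2), w.2.2.1 - (w.2.1 - w.2.2.2)))
      invFun := fun p =>
        (((1 / 2 : ℝ) • (p.1.1.1 + p.1.2.1), (1 / 2 : ℝ) • (p.1.1.1 + p.2.1),
          (1 / 2 : ℝ) • (p.1.2.1 + p.2.1)),
          ((1 / 2 : ℝ) • (p.1.1.2 + p.1.2.2), (1 / 2 : ℝ) • (p.1.1.2 + p.2.2),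
          (1 / 2 : ℝ) • (p.1.2.2 + p.2.2)))
      map_add' := fun x y => by
        refine Prod.ext (Prod.ext (Prod.ext ?_ ?_) (Prod.ext ?_ ?_)) (Prod.ext ?_ ?_) <;>
        · simp only [Prod.fst_add, Prod.snd_add]
          abel
      map_smul' := fun c x => by
        refine Prod.ext (Prod.ext (Prod.ext ?_ ?_) (Prod.ext ?_ ?_)) (Prod.ext ?_ ?_) <;>
        · simp only [Prod.smul_fst, Prod.smul_snd, RingHom.id_apply]
          module
      left_inv := fun w => by
        refine Prod.ext (Prod.ext ?_ (Prod.ext ?_ ?_)) (Prod.ext ?_ (Prod.ext ?_ ?_)) <;>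
        · dsimp only
          module
      right_inv := fun p => by
        refine Prod.ext (Prod.ext (Prod.ext ?_ ?_) (Prod.ext ?_ ?_)) (Prod.ext ?_ ?_) <;>
        · dsimp only
          module }

/-- Each half-side of a triangle is the difference of the midpoints of the other two sides, so every
kernel depends on the midpoints alone. The conjugated kernel contributes the term of the phase with
a minus sign. -/
theorem kernelTriple_vertexEquiv (κ : ℝ) (F₀ F₁ F₂ : (ℝ × E) × (E × ℝ) → ℂ) (a : ℝ × ℝ × ℝ)
    (s : E × E × E) :
    kernelTriple κ F₀ F₁ F₂ (vertexEquiv E (a, s)) =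
      (Real.sqrt (Real.cosh (2 * (a.2.1 - a.2.2)) * Real.cosh (2 * (a.1 - a.2.2)) *
        Real.cosh (2 * (a.2.1 - a.1))) : ℂ) *
        ∫ y : (E × ℝ) × (E × ℝ) × (E × ℝ),
          Complex.exp ((κ * darbouxPhase a s y : ℝ) * Complex.I) *
            (star (F₀ ((a.1, (Real.cosh (a.2.1 - a.2.2))⁻¹ • s.1), y.1)) *
              (F₁ ((a.2.1, (Real.cosh (a.1 - a.2.2))⁻¹ • s.2.1), y.2.1) *
                F₂ ((a.2.2, (Real.cosh (a.2.1 - a.1))⁻¹ • s.2.2), y.2.2))) := by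
  obtain ⟨a₀, a₁, a₂⟩ := a
  obtain ⟨s₀, s₁, s₂⟩ := s
  have h : vertexEquiv E ((a₀, a₁, a₂), (s₀, s₁, s₂)) =
    (((a₀ + (a₁ - a₂), s₀ + (s₁ - s₂)), (a₀ - (a₁ - a₂), s₀ - (s₁ - s₂))),
      (a₁ - (a₀ - a₂), s₁ - (s₀ - s₂))) := rfl
  rw [h]
  have e1 : ((a₀ + (a₁ - a₂), s₀ + (s₁ - s₂)) : ℝ × E) = (a₁ + (a₀ - a₂), s₁ + (s₀ - s₂)) :=
    Prod.ext (by dsimp only; ring) (by dsimp only; abel)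
  have e2 : ((a₁ - (a₀ - a₂), s₁ - (s₀ - s₂)) : ℝ × E) = (a₂ + (a₁ - a₀), s₂ + (s₁ - s₀)) :=
    Prod.ext (by dsimp only; ring) (by dsimp only; abel)
  have e3 : ((a₀ - (a₁ - a₂), s₀ - (s₁ - s₂)) : ℝ × E) = (a₂ - (a₁ - a₀), s₂ - (s₁ - s₀)) :=
    Prod.ext (by dsimp only; ring) (by dsimp only; abel)
  have k0 := quantKernel_midpoint κ F₀ a₀ (a₁ - a₂) s₀ (s₁ - s₂)
  have k1 := quantKernel_midpoint κ F₁ a₁ (a₀ - a₂) s₁ (s₀ - s₂)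
  have k2 := quantKernel_midpoint κ F₂ a₂ (a₁ - a₀) s₂ (s₁ - s₀)
  rw [← e1] at k1
  rw [← e2, ← e3] at k2
  simp only [kernelTriple, k0, k1, k2]
  rw [star_mul', Complex.star_def, Complex.conj_ofReal, ← integral_conj]
  rw [Real.sqrt_mul (by positivity), Real.sqrt_mul (by positivity), Complex.ofReal_mul,
    Complex.ofReal_mul]
  rw [show ∀ r₀ r₁ r₂ i₀ i₁ i₂ : ℂ, r₀ * i₀ * (r₁ * i₁ * (r₂ * i₂)) =
    r₀ * r₁ * r₂ * (i₀ * (i₁ * i₂)) by intros; ring]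
  congr 1
  rw [← integral_prod_mul, ← integral_prod_mul]
  refine integral_congr_ae (Filter.Eventually.of_forall fun y => ?_)
  simp only [darbouxPhase, map_mul, ← Complex.exp_conj, Complex.conj_ofReal, Complex.conj_I]
  have : ∀ x₀ x₁ x₂ f₀ f₁ f₂ : ℂ, Complex.exp x₀ * f₀ * (Complex.exp x₁ * f₁ *
      (Complex.exp x₂ * f₂)) = Complex.exp (x₀ + x₁ + x₂) * (f₀ * (f₁ * f₂)) := by
    intros; rw [Complex.exp_add, Complex.exp_add]; ring
  rw [this]
  congr 2
  push_cast
  ring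

theorem map_pos_smul_addHaar {r : ℝ} (hr : 0 < r) : (volume : Measure E).map (r • ·) =
    (r.toNNReal ^ Module.finrank ℝ E)⁻¹ • (volume : Measure E) := by
  rw [Measure.map_addHaar_smul _ hr.ne', abs_of_pos (by positivity)]
  change ENNReal.ofNNReal _ • _ = _
  rw [Real.toNNReal_inv, Real.toNNReal_pow hr.le]
  rfl

theorem map_smul_prodMap_addHaar {B : Type*} [MeasurableSpace B] (ρ : Measure B) [SFinite ρ]
    {φ : B → B} (hφ : Measurable φ) {k : ℝ≥0} (h : ρ.map φ = k • ρ) {r : ℝ} (hr : 0 < r) :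
    ((volume : Measure E).prod ρ).map (Prod.map (r • ·) φ) =
      ((r.toNNReal ^ Module.finrank ℝ E)⁻¹ * k) • (volume : Measure E).prod ρ := by
  rw [← Measure.map_prod_map _ _ (by fun_prop) hφ, map_pos_smul_addHaar hr, h]
  change Measure.prod ((_ : ℝ≥0∞) • (volume : Measure E)) ((k : ℝ≥0∞) • ρ) =
    (((r.toNNReal ^ Module.finrank ℝ E)⁻¹ * k : ℝ≥0) : ℝ≥0∞) • (volume : Measure E).prod ρ
  rw [Measure.prod_smul_left, Measure.prod_smul_right, smul_smul, ENNReal.coe_mul]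

/-- The Jacobian of the three substitutions `q = s / cosh`, one for each side of the triangle. -/
theorem integral_comp_smul_prod₃ (f : E × E × E → ℂ) {r₀ r₁ r₂ : ℝ} (h₀ : 0 < r₀) (h₁ : 0 < r₁)
    (h₂ : 0 < r₂) :
    ∫ s : E × E × E, f (r₀ • s.1, r₁ • s.2.1, r₂ • s.2.2) =
      (((r₀ * r₁ * r₂) ^ Module.finrank ℝ E)⁻¹ : ℝ) * ∫ s, f s := by
  let φ : (E × E × E) ≃ᵐ (E × E × E) :=
    (Homeomorph.prodCongr (Homeomorph.smul (Units.mk0 r₀ h₀.ne'))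
      (Homeomorph.prodCongr (Homeomorph.smul (Units.mk0 r₁ h₁.ne'))
        (Homeomorph.smul (Units.mk0 r₂ h₂.ne')))).toMeasurableEquiv
  have hm1 := map_smul_prodMap_addHaar (E := E) (volume : Measure E) (φ := (r₂ • ·)) (by fun_prop)
    (map_pos_smul_addHaar h₂) h₁
  have hm0 := map_smul_prodMap_addHaar (E := E) _ (φ := Prod.map (r₁ • ·) (r₂ • ·)) (by fun_prop)
    hm1 h₀
  have h := integral_map_equiv (μ := volume) φ f
  change ∫ y, f y ∂(((volume : Measure E).prod ((volume : Measure E).prod volume)).map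
    (Prod.map (r₀ • ·) (Prod.map (r₁ • ·) (r₂ • ·)))) =
      ∫ s : E × E × E, f (r₀ • s.1, r₁ • s.2.1, r₂ • s.2.2) at h
  rw [← h, hm0, integral_smul_nnreal_measure, NNReal.smul_def, Complex.real_smul]
  congr 2
  push_cast
  rw [Real.coe_toNNReal _ h₀.le, Real.coe_toNNReal _ h₁.le, Real.coe_toNNReal _ h₂.le]
  rw [← mul_inv, ← mul_inv, ← mul_pow, ← mul_pow, mul_assoc]

end TripleProduct

/-! ### Phase and amplitude in Darboux coordinates -/

section TripleIntegral

variable {E : Type*} [NormedAddCommGroup E] [InnerProductSpace ℝ E] [FiniteDimensional ℝ E]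
  {V : Type*} [NormedAddCommGroup V] [NormedSpace ℝ V] [FiniteDimensional ℝ V]

/-- Darboux coordinates `((a, q), (p, z))` on `R₀`. -/
noncomputable def R0.darbouxEquiv (e : V ≃ₗ[ℝ] E × E) : ((ℝ × E) × (E × ℝ)) ≃L[ℝ] R0 V :=
  LinearEquiv.toContinuousLinearEquiv
    { toFun := fun b => (b.1.1, e.symm (b.1.2, b.2.1), b.2.2)
      invFun := fun g => ((g.1, (e g.2.1).1), ((e g.2.1).2, g.2.2))
      map_add' := fun x y => by
        refine Prod.ext rfl (Prod.ext ?_ rfl)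
        change e.symm ((x.1.2, x.2.1) + (y.1.2, y.2.1)) = _
        rw [map_add]
        rfl
      map_smul' := fun c x => by
        refine Prod.ext rfl (Prod.ext ?_ rfl)
        change e.symm (c • (x.1.2, x.2.1)) = _
        rw [map_smul]
        rfl
      left_inv := fun b => by simp
      right_inv := fun g => by simp }

theorem R0.darbouxEquiv_apply (e : V ≃ₗ[ℝ] E × E) (b : (ℝ × E) × (E × ℝ)) :
    R0.darbouxEquiv e b = (b.1.1, e.symm (b.1.2, b.2.1), b.2.2) := rfl

/-- Regrouping of the Darboux coordinates of three points. -/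
noncomputable def regroupEquiv (E : Type*) [NormedAddCommGroup E] [InnerProductSpace ℝ E]
    [FiniteDimensional ℝ E] :
    ((ℝ × ℝ × ℝ) × (E × E × E) × ((E × ℝ) × (E × ℝ) × (E × ℝ))) ≃L[ℝ]
      ((ℝ × E) × (E × ℝ)) × ((ℝ × E) × (E × ℝ)) × ((ℝ × E) × (E × ℝ)) :=
  LinearEquiv.toContinuousLinearEquiv
    { toFun := fun w => (((w.1.1, w.2.1.1), w.2.2.1), ((w.1.2.1, w.2.1.2.1), w.2.2.2.1),
        ((w.1.2.2, w.2.1.2.2), w.2.2.2.2))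
      invFun := fun b => ((b.1.1.1, b.2.1.1.1, b.2.2.1.1), (b.1.1.2, b.2.1.1.2, b.2.2.1.2),
        (b.1.2, b.2.1.2, b.2.2.2))
      map_add' := fun _ _ => rfl
      map_smul' := fun _ _ => rfl
      left_inv := fun _ => rfl
      right_inv := fun _ => rfl }

/-- The coordinates `(a, q, y)` on triples of points of `R₀`. -/
noncomputable def R0.tripleEquiv (e : V ≃ₗ[ℝ] E × E) :
    ((ℝ × ℝ × ℝ) × (E × E × E) × ((E × ℝ) × (E × ℝ) × (E × ℝ))) ≃L[ℝ] R0 V × R0 V × R0 V :=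
  (regroupEquiv E).trans ((R0.darbouxEquiv e).prodCongr
    ((R0.darbouxEquiv e).prodCongr (R0.darbouxEquiv e)))

theorem R0.tripleEquiv_apply (e : V ≃ₗ[ℝ] E × E) (a : ℝ × ℝ × ℝ) (s : E × E × E)
    (y : (E × ℝ) × (E × ℝ) × (E × ℝ)) :
    R0.tripleEquiv e (a, s, y) = (R0.darbouxEquiv e ((a.1, s.1), y.1),
      R0.darbouxEquiv e ((a.2.1, s.2.1), y.2.1), R0.darbouxEquiv e ((a.2.2, s.2.2), y.2.2)) := rfl

/-- The dilations in `q` cancel the factors `cosh` that multiply the same vectors in `S`. What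
remains is linear in the fibre variables `(p, z)`, with the frequencies of the three kernels. -/
theorem R0.phase_eq_darbouxPhase (Ω : LinearMap.BilinForm ℝ V) (e : V ≃ₗ[ℝ] E × E)
    (he : ∀ x y, Ω x y = inner ℝ (e x).1 (e y).2 - inner ℝ (e y).1 (e x).2)
    (a : ℝ × ℝ × ℝ) (s : E × E × E) (y : (E × ℝ) × (E × ℝ) × (E × ℝ)) :
    R0.phase Ω
      (R0.darbouxEquiv e ((a.1, (Real.cosh (a.2.1 - a.2.2))⁻¹ • s.1), y.1))
      (R0.darbouxEquiv e ((a.2.1, (Real.cosh (a.1 - a.2.2))⁻¹ • s.2.1), y.2.1))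
      (R0.darbouxEquiv e ((a.2.2, (Real.cosh (a.2.1 - a.1))⁻¹ • s.2.2), y.2.2)) =
      darbouxPhase a s y := by
  obtain ⟨a₀, a₁, a₂⟩ := a
  obtain ⟨s₀, s₁, s₂⟩ := s
  obtain ⟨⟨p₀, z₀⟩, ⟨p₁, z₁⟩, ⟨p₂, z₂⟩⟩ := y
  have c1 : Real.cosh (a₂ - a₀) = Real.cosh (a₀ - a₂) := by rw [← Real.cosh_neg, neg_sub]
  have c2 : Real.cosh (a₀ - a₁) = Real.cosh (a₁ - a₀) := by rw [← Real.cosh_neg, neg_sub]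
  have d1 : Real.sinh (2 * (a₂ - a₀)) = -Real.sinh (2 * (a₀ - a₂)) := by
    rw [← Real.sinh_neg]; congr 1; ring
  have d2 : Real.sinh (2 * (a₀ - a₁)) = -Real.sinh (2 * (a₁ - a₀)) := by
    rw [← Real.sinh_neg]; congr 1; ring
  have n0 : Real.cosh (a₁ - a₂) ≠ 0 := (Real.cosh_pos _).ne'
  have n1 : Real.cosh (a₀ - a₂) ≠ 0 := (Real.cosh_pos _).ne'
  have n2 : Real.cosh (a₁ - a₀) ≠ 0 := (Real.cosh_pos _).ne'
  simp only [R0.darbouxEquiv_apply, R0.phase, R0.weylPhase, darbouxPhase, he, c1, c2, d1, d2]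
  simp only [map_smul, LinearEquiv.apply_symm_apply, Prod.smul_mk, smul_smul, mul_inv_cancel₀ n0,
    mul_inv_cancel₀ n1, mul_inv_cancel₀ n2, one_smul, inner_smul_right, inner_sub_left]
  ring

/-- As `dim V` is even, the square root leaves an integer power of the `cosh` factors: the Jacobian
of the `q`-dilations. The other factor is the product of the three kernel weights. -/
theorem R0.amplitude_eq (a : ℝ × ℝ × ℝ) (v₀ v₁ v₂ : V × ℝ) {n : ℕ}
    (hn : Module.finrank ℝ V = 2 * n) :
    R0.amplitude (a.1, v₀) (a.2.1, v₁) (a.2.2, v₂) =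
      Real.sqrt (Real.cosh (2 * (a.2.1 - a.2.2)) * Real.cosh (2 * (a.1 - a.2.2)) *
        Real.cosh (2 * (a.2.1 - a.1))) *
      (Real.cosh (a.2.1 - a.2.2) * Real.cosh (a.1 - a.2.2) * Real.cosh (a.2.1 - a.1)) ^ n := by
  obtain ⟨a₀, a₁, a₂⟩ := a
  have c1 : Real.cosh (a₂ - a₀) = Real.cosh (a₀ - a₂) := by rw [← Real.cosh_neg, neg_sub]
  have c2 : Real.cosh (a₀ - a₁) = Real.cosh (a₁ - a₀) := by rw [← Real.cosh_neg, neg_sub]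
  have d1 : Real.cosh (2 * (a₂ - a₀)) = Real.cosh (2 * (a₀ - a₂)) := by
    rw [← Real.cosh_neg]; congr 1; ring
  have d2 : Real.cosh (2 * (a₀ - a₁)) = Real.cosh (2 * (a₁ - a₀)) := by
    rw [← Real.cosh_neg]; congr 1; ring
  simp only [R0.amplitude, hn, c1, c2, d1, d2]
  rw [pow_mul', Real.sqrt_mul (by positivity), Real.sqrt_sq (by positivity)]

variable [MeasurableSpace V] [BorelSpace V]

instance (μ : Measure V) [μ.IsAddHaarMeasure] : (R0.haar μ).IsAddHaarMeasure :=
  have : (μ.prod (volume : Measure ℝ)).IsAddHaarMeasure := Measure.prod.instIsAddHaarMeasure _ _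
  Measure.prod.instIsAddHaarMeasure _ _

/-- The oscillating kernel of the product. -/
noncomputable def R0.starKernel (Ω : LinearMap.BilinForm ℝ V) (θ : ℝ) (g : R0 V × R0 V × R0 V) :
    ℂ :=
  (R0.amplitude g.1 g.2.1 g.2.2 : ℂ) *
    Complex.exp (2 * Complex.I / (θ : ℂ) * (R0.phase Ω g.1 g.2.1 g.2.2 : ℂ))

theorem R0.continuous_starKernel (Ω : LinearMap.BilinForm ℝ V) (θ : ℝ) :
    Continuous (R0.starKernel Ω θ) := by
  have hΩ : Continuous fun p : V × V => Ω p.1 p.2 :=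
    (LinearMap.toContinuousBilinearMap Ω).isBoundedBilinearMap.continuous
  have h1 : Continuous fun g : R0 V × R0 V × R0 V => R0.amplitude g.1 g.2.1 g.2.2 := by
    unfold R0.amplitude
    fun_prop
  have h2 : Continuous fun g : R0 V × R0 V × R0 V => R0.phase Ω g.1 g.2.1 g.2.2 := by
    unfold R0.phase R0.weylPhase
    have hΩ' {f g : R0 V × R0 V × R0 V → V} (hf : Continuous f) (hg : Continuous g) :
        Continuous fun x => Ω (f x) (g x) := hΩ.comp (hf.prodMk hg)
    refine Continuous.sub (Continuous.add (Continuous.add ?_ ?_) ?_) (by fun_prop)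
    all_goals exact hΩ' (by fun_prop) (by fun_prop)
  unfold R0.starKernel
  fun_prop

theorem R0.starFormula_eq (Ω : LinearMap.BilinForm ℝ V) (μ : Measure V) (θ : ℝ) (u v : R0 V → ℂ)
    (g₀ : R0 V) :
    R0.starFormula Ω μ θ u v g₀ = 1 / (θ : ℂ) ^ Module.finrank ℝ (R0 V) *
      ∫ p : R0 V × R0 V, R0.starKernel Ω θ (g₀, p) * (u p.1 * v p.2)
        ∂((R0.haar μ).prod (R0.haar μ)) := rfl

theorem R0.integrable_starKernel_mul (Ω : LinearMap.BilinForm ℝ V) (μ : Measure V)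
    [μ.IsAddHaarMeasure] (θ : ℝ) {w u v : R0 V → ℂ} (hw : Continuous w) (hw' : HasCompactSupport w)
    (hu : Continuous u) (hu' : HasCompactSupport u) (hv : Continuous v)
    (hv' : HasCompactSupport v) :
    Integrable (fun g : R0 V × R0 V × R0 V =>
      R0.starKernel Ω θ g * (star (w g.1) * (u g.2.1 * v g.2.2)))
      ((R0.haar μ).prod ((R0.haar μ).prod (R0.haar μ))) := by
  have h := R0.continuous_starKernel Ω θ
  refine Continuous.integrable_of_hasCompactSupport (by fun_prop) ?_
  refine HasCompactSupport.intro
    (hw'.isCompact.prod (hu'.isCompact.prod hv'.isCompact)) fun g hg => ?_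
  simp only [Set.mem_prod, not_and_or] at hg
  rcases hg with hg | hg | hg <;> simp [image_eq_zero_of_notMem_tsupport hg]

end TripleIntegral

/-! ### The star product as a trace -/

section TrilinearIdentity

variable {E : Type*} [NormedAddCommGroup E] [InnerProductSpace ℝ E] [FiniteDimensional ℝ E]
  [MeasurableSpace E] [BorelSpace E]
  {V : Type*} [NormedAddCommGroup V] [NormedSpace ℝ V] [FiniteDimensional ℝ V]
  [MeasurableSpace V] [BorelSpace V]

theorem R0.finrank_eq_of_darboux (e : V ≃ₗ[ℝ] E × E) :
    Module.finrank ℝ V = 2 * Module.finrank ℝ E := by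
  rw [e.finrank_eq, Module.finrank_prod, two_mul]

/-- With `a` fixed, substituting `q = s / cosh` on each side of the triangle matches the integrands
pointwise in `s`, so no integrability is required here. -/
theorem R0.integral_starKernel_fiber (Ω : LinearMap.BilinForm ℝ V) (θ : ℝ) (e : V ≃ₗ[ℝ] E × E)
    (he : ∀ x y, Ω x y = inner ℝ (e x).1 (e y).2 - inner ℝ (e y).1 (e x).2)
    (w u v : R0 V → ℂ) (a : ℝ × ℝ × ℝ) :
    ∫ s : E × E × E, ∫ y : (E × ℝ) × (E × ℝ) × (E × ℝ),
      R0.starKernel Ω θ (R0.tripleEquiv e (a, s, y)) *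
        (star (w (R0.tripleEquiv e (a, s, y)).1) *
          (u (R0.tripleEquiv e (a, s, y)).2.1 * v (R0.tripleEquiv e (a, s, y)).2.2)) =
    ∫ s : E × E × E, kernelTriple (2 / θ) (w ∘ R0.darbouxEquiv e) (u ∘ R0.darbouxEquiv e)
      (v ∘ R0.darbouxEquiv e) (vertexEquiv E (a, s)) := by
  set f : E × E × E → ℂ := fun s => ∫ y : (E × ℝ) × (E × ℝ) × (E × ℝ),
      R0.starKernel Ω θ (R0.tripleEquiv e (a, s, y)) *
        (star (w (R0.tripleEquiv e (a, s, y)).1) *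
          (u (R0.tripleEquiv e (a, s, y)).2.1 * v (R0.tripleEquiv e (a, s, y)).2.2)) with hf
  set c₀ := Real.cosh (a.2.1 - a.2.2) with hc₀
  set c₁ := Real.cosh (a.1 - a.2.2) with hc₁
  set c₂ := Real.cosh (a.2.1 - a.1) with hc₂
  have p₀ : 0 < c₀ := Real.cosh_pos _
  have p₁ : 0 < c₁ := Real.cosh_pos _
  have p₂ : 0 < c₂ := Real.cosh_pos _
  have hscale := integral_comp_smul_prod₃ f (inv_pos.2 p₀) (inv_pos.2 p₁) (inv_pos.2 p₂)
  set n := Module.finrank ℝ E with hn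
  have hpos : ((c₀ * c₁ * c₂) ^ n : ℝ) ≠ 0 := by positivity
  have hinv : ((c₀⁻¹ * c₁⁻¹ * c₂⁻¹) ^ n)⁻¹ = (c₀ * c₁ * c₂) ^ n := by
    rw [← mul_inv, ← mul_inv, inv_pow, inv_inv]
  rw [hinv] at hscale
  have hpt (s : E × E × E) :
      f (c₀⁻¹ • s.1, c₁⁻¹ • s.2.1, c₂⁻¹ • s.2.2) = ((c₀ * c₁ * c₂) ^ n : ℝ) *
        kernelTriple (2 / θ) (w ∘ R0.darbouxEquiv e) (u ∘ R0.darbouxEquiv e)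
          (v ∘ R0.darbouxEquiv e) (vertexEquiv E (a, s)) := by
    rw [kernelTriple_vertexEquiv, ← mul_assoc, ← Complex.ofReal_mul, ← integral_const_mul]
    refine integral_congr_ae (Filter.Eventually.of_forall fun y => ?_)
    have hph := R0.phase_eq_darbouxPhase Ω e he a s y
    have hamp := R0.amplitude_eq a (e.symm (c₀⁻¹ • s.1, y.1.1), y.1.2)
      (e.symm (c₁⁻¹ • s.2.1, y.2.1.1), y.2.1.2) (e.symm (c₂⁻¹ • s.2.2, y.2.2.1), y.2.2.2)
      (R0.finrank_eq_of_darboux e)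
    simp only [R0.tripleEquiv_apply, R0.starKernel, Function.comp_apply]
    rw [hph]
    simp only [R0.darbouxEquiv_apply]
    rw [hamp, mul_assoc]
    congr 1
    · rw [mul_comm]
    · congr 2
      push_cast
      ring
  simp_rw [hpt] at hscale
  rw [integral_const_mul] at hscale
  exact (mul_left_cancel₀ (by exact_mod_cast hpos) hscale).symm

-- Fubini over the fibres above `a`; `c` collects `θ^{-dim}` and the Haar factors of the two
-- coordinate changes. The star integrand is continuous with compact support, whereas the kernel
-- side has already been integrated over the fibres; its integrability is assumed and will come from
-- the Hilbert–Schmidt bound.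
set_option synthInstance.maxHeartbeats 400000 in
set_option synthInstance.maxSize 1000 in
theorem R0.exists_integral_star_eq_kernelTriple (Ω : LinearMap.BilinForm ℝ V)
    (e : V ≃ₗ[ℝ] E × E)
    (he : ∀ x y, Ω x y = inner ℝ (e x).1 (e y).2 - inner ℝ (e y).1 (e x).2)
    (μ : Measure V) [μ.IsAddHaarMeasure] (θ : ℝ) :
    ∃ c : ℂ, ∀ w u v : R0 V → ℂ, Continuous w → HasCompactSupport w → Continuous u →
      HasCompactSupport u → Continuous v → HasCompactSupport v →
      Integrable (kernelTriple (2 / θ) (w ∘ R0.darbouxEquiv e) (u ∘ R0.darbouxEquiv e)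
        (v ∘ R0.darbouxEquiv e)) →
      ∫ g, star (w g) * R0.starFormula Ω μ θ u v g ∂(R0.haar μ) =
        c * ∫ p, kernelTriple (2 / θ) (w ∘ R0.darbouxEquiv e) (u ∘ R0.darbouxEquiv e)
          (v ∘ R0.darbouxEquiv e) p := by
  obtain ⟨c₁, hc₁, h₁⟩ := (R0.tripleEquiv e).exists_integral_comp_eq volume
    ((R0.haar μ).prod ((R0.haar μ).prod (R0.haar μ)))
  obtain ⟨c₂, -, h₂⟩ := (vertexEquiv E).exists_integral_comp_eq volume volume
  refine ⟨1 / (θ : ℂ) ^ Module.finrank ℝ (R0 V) * (c₁⁻¹ * c₂),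
    fun w u v hw hw' hu hu' hv hv' hint => ?_⟩
  set Ψ : R0 V × R0 V × R0 V → ℂ := fun g =>
    R0.starKernel Ω θ g * (star (w g.1) * (u g.2.1 * v g.2.2)) with hΨ
  have hΨint : Integrable Ψ ((R0.haar μ).prod ((R0.haar μ).prod (R0.haar μ))) :=
    R0.integrable_starKernel_mul Ω μ θ hw hw' hu hu' hv hv'
  have hΨint' : Integrable fun z => Ψ (R0.tripleEquiv e z) :=
    ((R0.tripleEquiv e).integrable_comp_addHaar_iff volume _ Ψ).2 hΨint
  have hKint := ((vertexEquiv E).integrable_comp_addHaar_iff volume volume _).2 hint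
  have hL : ∫ g, star (w g) * R0.starFormula Ω μ θ u v g ∂(R0.haar μ) =
      1 / (θ : ℂ) ^ Module.finrank ℝ (R0 V) *
        ∫ g, Ψ g ∂((R0.haar μ).prod ((R0.haar μ).prod (R0.haar μ))) := by
    rw [integral_prod _ hΨint, ← integral_const_mul]
    refine integral_congr_ae (Filter.Eventually.of_forall fun g => ?_)
    dsimp only
    rw [R0.starFormula_eq, mul_left_comm, ← integral_const_mul]
    congr 1
    refine integral_congr_ae (Filter.Eventually.of_forall fun p => ?_)
    simp only [hΨ]
    ring
  have hM : ∫ z, Ψ (R0.tripleEquiv e z) = ∫ a : ℝ × ℝ × ℝ, ∫ s : E × E × E,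
      ∫ y : (E × ℝ) × (E × ℝ) × (E × ℝ), Ψ (R0.tripleEquiv e (a, s, y)) := by
    rw [Measure.volume_eq_prod] at hΨint' ⊢
    rw [integral_prod _ hΨint']
    refine integral_congr_ae ?_
    filter_upwards [hΨint'.prod_right_ae] with a ha
    rw [Measure.volume_eq_prod (E × E × E)] at ha ⊢
    rw [integral_prod _ ha]
  have hK : ∫ z, kernelTriple (2 / θ) (w ∘ R0.darbouxEquiv e) (u ∘ R0.darbouxEquiv e)
      (v ∘ R0.darbouxEquiv e) (vertexEquiv E z) = ∫ a : ℝ × ℝ × ℝ, ∫ s : E × E × E,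
        kernelTriple (2 / θ) (w ∘ R0.darbouxEquiv e) (u ∘ R0.darbouxEquiv e)
          (v ∘ R0.darbouxEquiv e) (vertexEquiv E (a, s)) := by
    rw [Measure.volume_eq_prod] at hKint ⊢
    rw [integral_prod _ hKint]
  have hfin : ∫ z, Ψ (R0.tripleEquiv e z) =
      ∫ z, kernelTriple (2 / θ) (w ∘ R0.darbouxEquiv e) (u ∘ R0.darbouxEquiv e)
        (v ∘ R0.darbouxEquiv e) (vertexEquiv E z) := by
    rw [hM, hK]
    exact integral_congr_ae (Filter.Eventually.of_forall fun a =>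
      R0.integral_starKernel_fiber Ω θ e he w u v a)
  rw [h₁, h₂] at hfin
  rw [hL, mul_assoc, mul_assoc c₁⁻¹, ← hfin, inv_mul_cancel_left₀ hc₁]

end TrilinearIdentity

/-! ### Test functions, density and uniqueness -/

namespace R0

variable {V : Type*} [NormedAddCommGroup V] [NormedSpace ℝ V]

/-- The space of smooth compactly supported functions. -/
def testFunctions (V : Type*) [NormedAddCommGroup V] [NormedSpace ℝ V] :
    Submodule ℂ (R0 V → ℂ) where
  carrier := {u | ContDiff ℝ ((⊤ : ℕ∞) : WithTop ℕ∞) u ∧ HasCompactSupport u}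
  add_mem' := fun hu hv => ⟨hu.1.add hv.1, hu.2.add hv.2⟩
  zero_mem' := ⟨contDiff_const, HasCompactSupport.zero⟩
  smul_mem' := fun c _ hu => ⟨contDiff_const.smul hu.1, hu.2.smul_left (f := fun _ => c)⟩

variable [FiniteDimensional ℝ V] [MeasurableSpace V] [BorelSpace V]

theorem memLp_testFunction (μ : Measure V) [μ.IsAddHaarMeasure] (u : testFunctions V) :
    MemLp (u : R0 V → ℂ) 2 (haar μ) :=
  u.2.1.continuous.memLp_of_hasCompactSupport u.2.2

/-- The inclusion of the test functions into `L²(R₀)`. -/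
noncomputable def testToLp (μ : Measure V) [μ.IsAddHaarMeasure] : testFunctions V →ₗ[ℂ] L2 μ where
  toFun u := (memLp_testFunction μ u).toLp
  map_add' _ _ := rfl
  map_smul' _ _ := rfl

theorem coeFn_testToLp (μ : Measure V) [μ.IsAddHaarMeasure] (u : testFunctions V) :
    testToLp μ u =ᵐ[haar μ] u :=
  (memLp_testFunction μ u).coeFn_toLp

theorem denseRange_testToLp (μ : Measure V) [μ.IsAddHaarMeasure] : DenseRange (testToLp μ) := by
  refine (Lp.dense_hasCompactSupport_contDiff (E := R0 V) (F := ℂ) (μ := haar μ)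
    (p := 2) (by simp)).mono ?_
  rintro f ⟨g, hfg, hg, hg'⟩
  exact ⟨⟨g, hg', hg⟩, Lp.ext ((coeFn_testToLp μ _).trans hfg.symm)⟩

theorem isHilbertStarProduct_iff (Ω : LinearMap.BilinForm ℝ V) (μ : Measure V)
    [μ.IsAddHaarMeasure] (θ : ℝ) (B : L2 μ →L[ℂ] L2 μ →L[ℂ] L2 μ) :
    IsHilbertStarProduct Ω μ θ B ↔ ∀ u v : testFunctions V,
      B (testToLp μ u) (testToLp μ v) =ᵐ[haar μ] starFormula Ω μ θ u v := by
  refine ⟨fun h u v => h u v u.2.1 u.2.2 v.2.1 v.2.2 _ _ (coeFn_testToLp μ u) (coeFn_testToLp μ v),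
    fun h u v hu hu' hv hv' f g hf hg => ?_⟩
  have e1 : f = testToLp μ ⟨u, hu, hu'⟩ := Lp.ext (hf.trans (coeFn_testToLp μ ⟨u, hu, hu'⟩).symm)
  have e2 : g = testToLp μ ⟨v, hv, hv'⟩ := Lp.ext (hg.trans (coeFn_testToLp μ ⟨v, hv, hv'⟩).symm)
  rw [e1, e2]
  exact h _ _

theorem ext_testToLp (μ : Measure V) [μ.IsAddHaarMeasure] {B B' : L2 μ → L2 μ → L2 μ}
    (hB : Continuous fun p : L2 μ × L2 μ => B p.1 p.2)
    (hB' : Continuous fun p : L2 μ × L2 μ => B' p.1 p.2)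
    (h : ∀ u v, B (testToLp μ u) (testToLp μ v) = B' (testToLp μ u) (testToLp μ v)) (f g : L2 μ) :
    B f g = B' f g := by
  have hd := (denseRange_testToLp μ).prodMap (denseRange_testToLp μ)
  exact congr_fun (hd.equalizer hB hB' (funext fun p => h p.1 p.2)) (f, g)

theorem IsHilbertStarProduct.unique {Ω : LinearMap.BilinForm ℝ V} {μ : Measure V}
    [μ.IsAddHaarMeasure] {θ : ℝ} {B B' : L2 μ →L[ℂ] L2 μ →L[ℂ] L2 μ}
    (h : IsHilbertStarProduct Ω μ θ B) (h' : IsHilbertStarProduct Ω μ θ B') : B = B' := by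
  rw [isHilbertStarProduct_iff] at h h'
  ext1 f
  ext1 g
  exact ext_testToLp μ (B := fun f g => B f g) (B' := fun f g => B' f g)
    B.isBoundedBilinearMap.continuous B'.isBoundedBilinearMap.continuous
    (fun u v => Lp.ext ((h u v).trans (h' u v).symm)) f g

/-- The `g₁, g₂` integral runs over a fixed compact set. Continuity supplies the local integrability
needed to identify the formula by testing. -/
theorem continuous_starFormula (Ω : LinearMap.BilinForm ℝ V) (μ : Measure V)
    [μ.IsAddHaarMeasure] (θ : ℝ) (u v : testFunctions V) :
    Continuous (starFormula Ω μ θ u v) := by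
  have hu := u.2.1.continuous
  have hv := v.2.1.continuous
  have hk := continuous_starKernel Ω θ
  have hc : Continuous (Function.uncurry fun (g₀ : R0 V) (p : R0 V × R0 V) =>
      starKernel Ω θ (g₀, p) * ((u : R0 V → ℂ) p.1 * (v : R0 V → ℂ) p.2)) := by
    unfold Function.uncurry
    fun_prop
  have h := continuous_parametric_integral_of_continuous (μ := (haar μ).prod (haar μ)) hc
    (u.2.2.isCompact.prod v.2.2.isCompact)
  have hset (g₀ : R0 V) := setIntegral_eq_integral_of_forall_compl_eq_zero
    (μ := (haar μ).prod (haar μ)) (s := tsupport (u : R0 V → ℂ) ×ˢ tsupport (v : R0 V → ℂ))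
    (f := fun p => starKernel Ω θ (g₀, p) * ((u : R0 V → ℂ) p.1 * (v : R0 V → ℂ) p.2))
    (fun p hp => by
      rcases not_and_or.1 hp with hp | hp <;> simp [image_eq_zero_of_notMem_tsupport hp])
  simp only [hset] at h
  exact continuous_const.mul h

/-! ### Existence of the product -/

section Existence

variable {E : Type*} [NormedAddCommGroup E] [InnerProductSpace ℝ E] [FiniteDimensional ℝ E]
  [MeasurableSpace E] [BorelSpace E]

theorem contDiff_testFunction_comp (e : V ≃ₗ[ℝ] E × E) (u : testFunctions V) :
    ContDiff ℝ ((⊤ : ℕ∞) : WithTop ℕ∞) ((u : R0 V → ℂ) ∘ darbouxEquiv e) :=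
  u.2.1.comp (darbouxEquiv e).contDiff

theorem hasCompactSupport_testFunction_comp (e : V ≃ₗ[ℝ] E × E) (u : testFunctions V) :
    HasCompactSupport ((u : R0 V → ℂ) ∘ darbouxEquiv e) :=
  u.2.2.comp_homeomorph (darbouxEquiv e).toHomeomorph

/-- The Hilbert space of integral kernels. -/
abbrev KernelL2 (E : Type*) [NormedAddCommGroup E] [InnerProductSpace ℝ E]
    [FiniteDimensional ℝ E] [MeasurableSpace E] [BorelSpace E] : Type _ :=
  Lp ℂ 2 ((volume : Measure (ℝ × E)).prod (volume : Measure (ℝ × E)))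

theorem memLp_quantKernel (e : V ≃ₗ[ℝ] E × E) {κ : ℝ} (hκ : κ ≠ 0) (u : testFunctions V) :
    MemLp (quantKernel κ ((u : R0 V → ℂ) ∘ darbouxEquiv e)) 2
      ((volume : Measure (ℝ × E)).prod (volume : Measure (ℝ × E))) := by
  have hu := contDiff_testFunction_comp e u
  have hu' := hasCompactSupport_testFunction_comp e u
  obtain ⟨C, hC⟩ := exists_lintegral_quantKernel_le (E := E) hκ
  refine ⟨(stronglyMeasurable_quantKernel κ hu.continuous).aestronglyMeasurable, ?_⟩
  have h2 : MemLp ((u : R0 V → ℂ) ∘ darbouxEquiv e) 2 volume :=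
    hu.continuous.memLp_of_hasCompactSupport hu'
  have h := (hC _ hu hu').trans_lt (ENNReal.mul_lt_top (by simp) h2.lintegral_enorm_sq_lt_top)
  rw [← Measure.volume_eq_prod]
  rw [← eLpNorm_two_sq_eq_lintegral] at h
  exact (ENNReal.pow_lt_top_iff.1 h).resolve_right (by simp)

/-- The quantization map on test functions. -/
noncomputable def quantTest (e : V ≃ₗ[ℝ] E × E) {κ : ℝ} (hκ : κ ≠ 0) :
    testFunctions V →ₗ[ℂ] KernelL2 E where
  toFun u := (memLp_quantKernel e hκ u).toLp
  map_add' u v := by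
    rw [← MemLp.toLp_add]
    congr 1
    exact quantKernel_add κ (contDiff_testFunction_comp e u).continuous
      (hasCompactSupport_testFunction_comp e u) (contDiff_testFunction_comp e v).continuous
      (hasCompactSupport_testFunction_comp e v)
  map_smul' c u := by
    rw [RingHom.id_apply, ← MemLp.toLp_const_smul]
    congr 1
    exact quantKernel_smul κ c _

theorem exists_norm_quantTest_le (e : V ≃ₗ[ℝ] E × E) {κ : ℝ} (hκ : κ ≠ 0) (μ : Measure V)
    [μ.IsAddHaarMeasure] : ∃ C : ℝ, ∀ u, ‖quantTest e hκ u‖ ≤ C * ‖testToLp μ u‖ := by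
  obtain ⟨C₁, h₁⟩ := exists_lintegral_quantKernel_le (E := E) hκ
  obtain ⟨C₂, h₂⟩ := (darbouxEquiv e).exists_lintegral_comp_eq volume (haar μ)
  refine ⟨Real.sqrt (C₁ * C₂), fun u => ?_⟩
  have h := h₁ _ (contDiff_testFunction_comp e u) (hasCompactSupport_testFunction_comp e u)
  have h' := h₂ fun g => ‖(u : R0 V → ℂ) g‖ₑ ^ 2
  simp only [Function.comp_apply] at h
  rw [h', ← eLpNorm_two_sq_eq_lintegral, ← eLpNorm_two_sq_eq_lintegral] at h
  have hu : ‖testToLp μ u‖ = (eLpNorm (u : R0 V → ℂ) 2 (haar μ)).toReal := Lp.norm_toLp _ (memLp_testFunction μ u)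
  have hK : ‖quantTest e hκ u‖ =
      (eLpNorm (quantKernel κ ((u : R0 V → ℂ) ∘ darbouxEquiv e)) 2 volume).toReal :=
    Lp.norm_toLp _ (memLp_quantKernel e hκ u)
  have hfin := (memLp_testFunction μ u).eLpNorm_ne_top
  have hsq : ‖quantTest e hκ u‖ ^ 2 ≤ C₁ * C₂ * ‖testToLp μ u‖ ^ 2 := by
    rw [hu, hK, ← ENNReal.toReal_pow, ← ENNReal.toReal_pow]
    have := ENNReal.toReal_mono (ENNReal.mul_ne_top ENNReal.coe_ne_top
      (ENNReal.mul_ne_top ENNReal.coe_ne_top (ENNReal.pow_ne_top hfin))) h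
    simpa only [ENNReal.toReal_mul, ENNReal.coe_toReal, mul_assoc] using this
  refine le_of_sq_le_sq ?_ (by positivity)
  rw [mul_pow, Real.sq_sqrt (by positivity)]
  exact hsq

/-- The quantization map on `L²(R₀)`. -/
noncomputable def quantization (e : V ≃ₗ[ℝ] E × E) {κ : ℝ} (hκ : κ ≠ 0) (μ : Measure V)
    [μ.IsAddHaarMeasure] : L2 μ →L[ℂ] KernelL2 E :=
  (quantTest e hκ).extendOfNorm (testToLp μ)

theorem quantization_testToLp (e : V ≃ₗ[ℝ] E × E) {κ : ℝ} (hκ : κ ≠ 0) (μ : Measure V)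
    [μ.IsAddHaarMeasure] (u : testFunctions V) :
    quantization e hκ μ (testToLp μ u) = quantTest e hκ u :=
  LinearMap.extendOfNorm_eq (denseRange_testToLp μ) (exists_norm_quantTest_le e hκ μ) u

/-- The product transported from the composition of Hilbert–Schmidt operators. -/
noncomputable def composedProduct (e : V ≃ₗ[ℝ] E × E) {κ : ℝ} (hκ : κ ≠ 0) (μ : Measure V)
    [μ.IsAddHaarMeasure] : L2 μ →L[ℂ] L2 μ →L[ℂ] L2 μ :=
  (ContinuousLinearMap.compL ℂ (L2 μ) (KernelL2 E) (L2 μ)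
    (ContinuousLinearMap.adjoint (quantization e hκ μ))).comp
    ((hilbertSchmidtComp (volume : Measure (ℝ × E))).bilinearComp (quantization e hκ μ)
      (quantization e hκ μ))

/-- Moving the adjoint across the inner product turns the coefficient into the Hilbert–Schmidt
pairing of one kernel with the composition of the other two, which is an iterated form of the triple
integral. -/
theorem inner_composedProduct (e : V ≃ₗ[ℝ] E × E) {κ : ℝ} (hκ : κ ≠ 0) (μ : Measure V)
    [μ.IsAddHaarMeasure] (w u v : testFunctions V) :
    Integrable (kernelTriple κ ((w : R0 V → ℂ) ∘ darbouxEquiv e)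
      ((u : R0 V → ℂ) ∘ darbouxEquiv e) ((v : R0 V → ℂ) ∘ darbouxEquiv e)) ∧
    inner ℂ (testToLp μ w) (composedProduct e hκ μ (testToLp μ u) (testToLp μ v)) =
      ∫ p, kernelTriple κ ((w : R0 V → ℂ) ∘ darbouxEquiv e)
        ((u : R0 V → ℂ) ∘ darbouxEquiv e) ((v : R0 V → ℂ) ∘ darbouxEquiv e) p := by
  have hm (u : testFunctions V) := stronglyMeasurable_quantKernel κ
    (contDiff_testFunction_comp e u).continuous
  have hi := integrable_triple_kernel (hm w) (hm u) (hm v) (memLp_quantKernel e hκ w)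
    (memLp_quantKernel e hκ u) (memLp_quantKernel e hκ v)
  refine ⟨hi, ?_⟩
  change inner ℂ (testToLp μ w) (ContinuousLinearMap.adjoint (quantization e hκ μ)
    (hilbertSchmidtComp volume (quantization e hκ μ (testToLp μ u))
      (quantization e hκ μ (testToLp μ v)))) = _
  rw [ContinuousLinearMap.adjoint_inner_right, quantization_testToLp, quantization_testToLp,
    quantization_testToLp, MeasureTheory.L2.inner_def]
  refine Eq.trans ?_ (integral_prod _ hi).symm
  refine integral_congr_ae ?_
  filter_upwards [(memLp_quantKernel e hκ w).coeFn_toLp,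
    hilbertSchmidtComp_toLp (memLp_quantKernel e hκ u) (memLp_quantKernel e hκ v)] with x hx hx'
  change inner ℂ ((memLp_quantKernel e hκ w).toLp _ x) (hilbertSchmidtComp volume
    ((memLp_quantKernel e hκ u).toLp _) ((memLp_quantKernel e hκ v).toLp _) x) = _
  rw [hx, hx', RCLike.inner_apply, kernelComp, mul_comm, ← integral_const_mul]
  rfl

theorem exists_isHilbertStarProduct (Ω : LinearMap.BilinForm ℝ V) (e : V ≃ₗ[ℝ] E × E)
    (he : ∀ x y, Ω x y = inner ℝ (e x).1 (e y).2 - inner ℝ (e y).1 (e x).2)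
    (μ : Measure V) [μ.IsAddHaarMeasure] {θ : ℝ} (hθ : θ ≠ 0) :
    ∃ B : L2 μ →L[ℂ] L2 μ →L[ℂ] L2 μ, IsHilbertStarProduct Ω μ θ B := by
  have hκ : 2 / θ ≠ 0 := div_ne_zero two_ne_zero hθ
  obtain ⟨c, hc⟩ := exists_integral_star_eq_kernelTriple Ω e he μ θ
  refine ⟨c • composedProduct e hκ μ, (isHilbertStarProduct_iff Ω μ θ _).2 fun u v => ?_⟩
  -- Two locally integrable functions with equal integrals against all real test functions agree
  -- almost everywhere; this converts the weak identity into the required formula.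
  refine ae_eq_of_integral_contDiff_smul_eq
    ((Lp.memLp _).locallyIntegrable (by norm_num))
    (continuous_starFormula Ω μ θ u v).locallyIntegrable fun g hg hg' => ?_
  let w : testFunctions V := ⟨fun x => (g x : ℂ), Complex.ofRealCLM.contDiff.comp hg,
    hg'.comp_left (g := fun r : ℝ => (r : ℂ)) Complex.ofReal_zero⟩
  obtain ⟨hi, h⟩ := inner_composedProduct e hκ μ w u v
  have h2 := hc w u v w.2.1.continuous w.2.2 u.2.1.continuous u.2.2 v.2.1.continuous v.2.2 hi
  rw [← h, ← inner_smul_right, MeasureTheory.L2.inner_def] at h2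
  have hstar (x : R0 V) : star ((w : R0 V → ℂ) x) = (g x : ℂ) := Complex.conj_ofReal _
  simp only [hstar] at h2
  simp only [Complex.real_smul]
  rw [h2]
  refine integral_congr_ae ?_
  filter_upwards [coeFn_testToLp μ w] with x hx
  rw [hx, RCLike.inner_apply, mul_comm]
  congr 1
  exact (hstar x).symm

end Existence

end R0

/-! ### Left invariance and smooth vectors -/

namespace R0

variable {V : Type*} [NormedAddCommGroup V] [NormedSpace ℝ V]

theorem mul_inv_mul (Ω : LinearMap.BilinForm ℝ V) (hΩ : Ω.IsAlt) (g h : R0 V) :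
    mul Ω g (mul Ω (inv g) h) = h :=
  @mul_inv_cancel_left _ (group Ω hΩ) g h

theorem inv_mul_mul (Ω : LinearMap.BilinForm ℝ V) (hΩ : Ω.IsAlt) (g h : R0 V) :
    mul Ω (inv g) (mul Ω g h) = h :=
  @inv_mul_cancel_left _ (group Ω hΩ) g h

/-- Only differences of the `a`-coordinates enter the hyperbolic factors. The terms that involve `x`
and `z` of the translating element cancel once everything is written in the `exp aᵢ`, with `Ω`
alternating. -/
theorem phase_mul_left (Ω : LinearMap.BilinForm ℝ V) (hΩ : Ω.IsAlt) (g g₀ g₁ g₂ : R0 V) :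
    phase Ω (mul Ω g g₀) (mul Ω g g₁) (mul Ω g g₂) = phase Ω g₀ g₁ g₂ := by
  obtain ⟨a, x, z⟩ := g
  obtain ⟨a₀, x₀, z₀⟩ := g₀
  obtain ⟨a₁, x₁, z₁⟩ := g₁
  obtain ⟨a₂, x₂, z₂⟩ := g₂
  have n0 : Ω x₀ x = -Ω x x₀ := (hΩ.neg_eq _ _).symm
  have n1 : Ω x₁ x = -Ω x x₁ := (hΩ.neg_eq _ _).symm
  have n2 : Ω x₂ x = -Ω x x₂ := (hΩ.neg_eq _ _).symm
  have i0 : Real.exp (-a₀) = (Real.exp a₀)⁻¹ := Real.exp_neg _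
  have i1 : Real.exp (-a₁) = (Real.exp a₁)⁻¹ := Real.exp_neg _
  have i2 : Real.exp (-a₂) = (Real.exp a₂)⁻¹ := Real.exp_neg _
  have d (t : ℝ) : Real.exp (2 * t) = Real.exp t ^ 2 := by rw [← Real.exp_nat_mul]; simp
  have d' (t : ℝ) : Real.exp (-2 * t) = (Real.exp t ^ 2)⁻¹ := by
    rw [← d, ← Real.exp_neg, neg_mul]
  have p0 := Real.exp_pos a₀
  have p1 := Real.exp_pos a₁
  have p2 := Real.exp_pos a₂
  simp only [phase, weylPhase, mul, add_sub_add_left_eq_sub, map_add, map_smul,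
    LinearMap.add_apply, LinearMap.smul_apply, smul_eq_mul, hΩ.self_eq_zero, n0, n1, n2,
    Real.cosh_eq, Real.sinh_eq, neg_sub, ← mul_neg, d, d', Real.exp_sub, i0, i1, i2]
  field_simp
  ring

theorem amplitude_mul_left (Ω : LinearMap.BilinForm ℝ V) (g g₀ g₁ g₂ : R0 V) :
    amplitude (mul Ω g g₀) (mul Ω g g₁) (mul Ω g g₂) = amplitude g₀ g₁ g₂ := by
  simp only [amplitude, mul, add_sub_add_left_eq_sub]

theorem starKernel_mul_left (Ω : LinearMap.BilinForm ℝ V) (hΩ : Ω.IsAlt) (θ : ℝ)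
    (g g₀ g₁ g₂ : R0 V) :
    starKernel Ω θ (mul Ω g g₀, mul Ω g g₁, mul Ω g g₂) = starKernel Ω θ (g₀, g₁, g₂) := by
  simp only [starKernel, phase_mul_left Ω hΩ, amplitude_mul_left]

variable [FiniteDimensional ℝ V]

theorem contDiff_mul_left (Ω : LinearMap.BilinForm ℝ V) (g : R0 V) :
    ContDiff ℝ ((⊤ : ℕ∞) : WithTop ℕ∞) (mul Ω g) := by
  have h : ContDiff ℝ ((⊤ : ℕ∞) : WithTop ℕ∞) fun x : V => Ω g.2.1 x :=
    (LinearMap.toContinuousLinearMap (Ω g.2.1)).contDiff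
  unfold mul
  have h' : ContDiff ℝ ((⊤ : ℕ∞) : WithTop ℕ∞) fun k : R0 V => Ω g.2.1 k.2.1 :=
    h.comp (by fun_prop)
  fun_prop

/-- Left translation as a homeomorphism. -/
noncomputable def leftTranslation (Ω : LinearMap.BilinForm ℝ V) (hΩ : Ω.IsAlt) (g : R0 V) : R0 V ≃ₜ R0 V where
  toFun := mul Ω g
  invFun := mul Ω (inv g)
  left_inv := inv_mul_mul Ω hΩ g
  right_inv := mul_inv_mul Ω hΩ g
  continuous_toFun := (contDiff_mul_left Ω g).continuous
  continuous_invFun := (contDiff_mul_left Ω (inv g)).continuous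

variable [MeasurableSpace V] [BorelSpace V]

theorem starFormula_comp_mul_left (Ω : LinearMap.BilinForm ℝ V) (hΩ : Ω.IsAlt) (μ : Measure V)
    [μ.IsAddHaarMeasure] (θ : ℝ) (u v : R0 V → ℂ) (g g₀ : R0 V) :
    starFormula Ω μ θ (u ∘ mul Ω g) (v ∘ mul Ω g) g₀ = starFormula Ω μ θ u v (mul Ω g g₀) := by
  have hmp := measurePreserving_mul_left Ω μ g
  have hemb : MeasurableEmbedding (Prod.map (mul Ω g) (mul Ω g)) :=
    ((leftTranslation Ω hΩ g).prodCongr (leftTranslation Ω hΩ g)).measurableEmbedding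
  rw [starFormula_eq, starFormula_eq, ← (hmp.prod hmp).integral_comp hemb
    fun p => starKernel Ω θ (mul Ω g g₀, p) * (u p.1 * v p.2)]
  congr 1
  refine integral_congr_ae (Filter.Eventually.of_forall fun p => ?_)
  simp only [Prod.map, starKernel_mul_left Ω hΩ, Function.comp_apply]

/-- Left translation of a test function. -/
noncomputable def translateTest (Ω : LinearMap.BilinForm ℝ V) (hΩ : Ω.IsAlt) (g : R0 V)
    (u : testFunctions V) : testFunctions V :=
  ⟨(u : R0 V → ℂ) ∘ mul Ω (inv g), u.2.1.comp (contDiff_mul_left Ω _),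
    u.2.2.comp_homeomorph (leftTranslation Ω hΩ (inv g))⟩

theorem coeFn_leftRegular (Ω : LinearMap.BilinForm ℝ V) (μ : Measure V) [μ.IsAddHaarMeasure]
    (g : R0 V) (f : L2 μ) : leftRegular Ω μ g f =ᵐ[haar μ] f ∘ mul Ω (inv g) :=
  Lp.coeFn_compMeasurePreserving f (measurePreserving_mul_left Ω μ (inv g))

theorem leftRegular_testToLp (Ω : LinearMap.BilinForm ℝ V) (hΩ : Ω.IsAlt) (μ : Measure V)
    [μ.IsAddHaarMeasure] (g : R0 V) (u : testFunctions V) :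
    leftRegular Ω μ g (testToLp μ u) = testToLp μ (translateTest Ω hΩ g u) := by
  refine Lp.ext ((coeFn_leftRegular Ω μ g _).trans (Filter.EventuallyEq.trans ?_
    (coeFn_testToLp μ _).symm))
  exact (measurePreserving_mul_left Ω μ (inv g)).quasiMeasurePreserving.ae_eq
    (coeFn_testToLp μ u)

/-- On test functions this is invariance of the kernel and of the Haar measure; both sides are
jointly continuous, so density extends it to all of `L²`. -/
theorem IsHilbertStarProduct.leftRegular_apply {Ω : LinearMap.BilinForm ℝ V} (hΩ : Ω.IsAlt)
    {μ : Measure V} [μ.IsAddHaarMeasure] {θ : ℝ} {B : L2 μ →L[ℂ] L2 μ →L[ℂ] L2 μ}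
    (hB : IsHilbertStarProduct Ω μ θ B) (g : R0 V) (f h : L2 μ) :
    leftRegular Ω μ g (B f h) = B (leftRegular Ω μ g f) (leftRegular Ω μ g h) := by
  have hl := (leftRegular Ω μ g).continuous
  have hc := B.isBoundedBilinearMap.continuous
  refine ext_testToLp μ (B := fun f h => leftRegular Ω μ g (B f h))
    (B' := fun f h => B (leftRegular Ω μ g f) (leftRegular Ω μ g h)) (hl.comp hc)
    (hc.comp ((hl.comp continuous_fst).prodMk (hl.comp continuous_snd))) (fun u v => ?_) f h
  rw [isHilbertStarProduct_iff] at hB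
  rw [leftRegular_testToLp Ω hΩ, leftRegular_testToLp Ω hΩ]
  refine Lp.ext ((coeFn_leftRegular Ω μ g _).trans (Filter.EventuallyEq.trans ?_
    (hB (translateTest Ω hΩ g u) (translateTest Ω hΩ g v)).symm))
  refine ((measurePreserving_mul_left Ω μ (inv g)).quasiMeasurePreserving.ae_eq
    (hB u v)).trans (Filter.Eventually.of_forall fun x => ?_)
  exact (starFormula_comp_mul_left Ω hΩ μ θ u v (inv g) x).symm

theorem mem_smoothVectors_iff {Ω : LinearMap.BilinForm ℝ V} {μ : Measure V}
    [μ.IsAddHaarMeasure] {u : L2 μ} : u ∈ smoothVectors Ω μ ↔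
      ContDiff ℝ ((⊤ : ℕ∞) : WithTop ℕ∞) fun g : R0 V => leftRegular Ω μ g u :=
  Set.mem_ofPred_eq ▸ Iff.rfl

theorem IsHilbertStarProduct.mem_smoothVectors {Ω : LinearMap.BilinForm ℝ V} (hΩ : Ω.IsAlt)
    {μ : Measure V} [μ.IsAddHaarMeasure] {θ : ℝ} {B : L2 μ →L[ℂ] L2 μ →L[ℂ] L2 μ}
    (hB : IsHilbertStarProduct Ω μ θ B) {u v : L2 μ} (hu : u ∈ smoothVectors Ω μ)
    (hv : v ∈ smoothVectors Ω μ) : B u v ∈ smoothVectors Ω μ := by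
  rw [mem_smoothVectors_iff] at hu hv ⊢
  simp only [hB.leftRegular_apply hΩ]
  -- By equivariance the orbit map of the product is `B` applied to the pair of orbit maps. Scalars
  -- are restricted because smoothness is over `ℝ` while `B` is complex bilinear.
  exact (ContinuousLinearMap.isBoundedBilinearMap
    (ContinuousLinearMap.bilinearRestrictScalars ℝ B)).contDiff.comp (hu.prodMk hv)

end R0

theorem mainTheorem8 {V : Type*} [NormedAddCommGroup V] [NormedSpace ℝ V]
    [FiniteDimensional ℝ V] [MeasurableSpace V] [BorelSpace V]
    (Ω : LinearMap.BilinForm ℝ V) (hΩ : Ω.IsAlt) (hΩ' : Ω.Nondegenerate)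
    (μ : MeasureTheory.Measure V) [μ.IsAddHaarMeasure] (θ : ℝ) (hθ : θ ≠ 0) :
    (∃! B : R0.L2 μ →L[ℂ] R0.L2 μ →L[ℂ] R0.L2 μ, R0.IsHilbertStarProduct Ω μ θ B) ∧
      ∀ B : R0.L2 μ →L[ℂ] R0.L2 μ →L[ℂ] R0.L2 μ, R0.IsHilbertStarProduct Ω μ θ B →
        ∀ u ∈ R0.smoothVectors Ω μ, ∀ v ∈ R0.smoothVectors Ω μ,
          B u v ∈ R0.smoothVectors Ω μ := by
  obtain ⟨n, e, he⟩ := LinearMap.BilinForm.exists_darboux Ω hΩ hΩ'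
  obtain ⟨B, hB⟩ := R0.exists_isHilbertStarProduct Ω e he μ hθ
  exact ⟨⟨B, hB, fun B' hB' => hB'.unique hB⟩,
    fun B hB u hu v hv => hB.mem_smoothVectors hΩ hu hv⟩
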